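/- **Setting.** Let $r\ge 2$ and let $H$ be an edge-critical, strictly $2$-balanced graph with $\chi(H)=r+1$; i.e. $\chi(H\setminus e)\le r$ for some edge $e$, and the maximum in $m_2(H)=\max\{\frac{e_F-1}{v_F-2}: F\subseteq H,\ e_F\ge 2\}$ is attained only at $F=H$. Let $K_r(m)^+$ be the balanced complete $r$-partite graph with parts of size $m$ plus one edge inside a part, let $\pi_H=\lim_{m\to\infty} N(H,K_r(m)^+)/m^{v_H-2}$, where $N(H,\cdot)$ counts copies of $H$, let $\theta_H>0$ satisfy $r^{2-v_H}\pi_H\theta_H^{e_H-1}=2-1/m_2(H)$, and put $p_H=\theta_H n^{-1/m_2(H)}(\log n)^{1/(e_H-1)}$. Fix $p_0\in(0,1)$ and positive constants $\varepsilon,\alpha,\delta,\kappa,\eta$, with $\alpha$ sufficiently small in terms of $r,p_0$, and $\delta$ sufficiently small in terms of $r,p_0,\alpha$. Let $p=p(n)$ satisfy $(1+\varepsilon)p_H\le p\le p_0$ for all large $n$. **Cuts.** Subgraphs of $K_n$ are identified with their edge sets. For a family $S$ of pairwise disjoint vertex sets, $\mathrm{ext}(S)$ is the set of pairs meeting two distinct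 members of $S$ and $\mathrm{int}(S)$ the set of pairs contained in one member. An $r$-cut is an ordered partition $\Pi=(V_1,\dots,V_r)$ of the vertex set; it is $\delta$-balanced if $|V_i|=(1\pm\delta)n/r$ for all $i$. For a set $\mathcal C$ of $r$-cuts, $b_{\mathcal C}(G)=\max_{\Pi\in\mathcal C}e(G\cap\mathrm{ext}(\Pi))$, and the deficit of $\Pi\in\mathcal C$ in $G$ is $b_{\mathcal C}(G)-e(G\cap \mathrm{ext}(\Pi))$. Two vertices are equivalent if they lie in the same part of every $\Pi\in\mathcal C$ of deficit $0$; $G$ is $\mathcal C$-rigid if at least $(1-\alpha)n^2/(2r)$ pairs of vertices are equivalent; its core $\mathrm{core}_{\mathcal C}(G)$ is the collection of equivalence classes with more than $(1-4r\alpha)n/r$ vertices. **Coloured graphs.** An $[r]$-coloured graph $Q\subseteq K_n$ has its vertices (the endpoints of its edges) coloured with $1,\dots,r$; $V^k(Q)$ is the set of vertices of colour $k$, $v_{\min}(Q)$ is the smallest size of a nonempty $V^k(Q)$ ($\infty$ if $Q$ is empty), and $\mathcal C_Q$ is the set of $\delta$-balanced $r$-cuts with $V^k(Q)\subseteq V_k$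 for all $k$. The family $\mathcal Q$ consists of (L) the $Q$ with maximum degree at most $\kappa np/\log n$ and all vertices of colour $1$, and (H) the $Q$ with an independent set $X\subseteq V^1(Q)$ of $k(Q)=o(n)$ (centre) vertices that meets all edges of $Q$ and in which each vertex has exactly $\lceil\eta np\rceil$ neighbours in every colour class. **Typical graphs.** $\mathcal T$ is the set of graphs $G$ on $n$ vertices such that: (T1) all degrees are $(1\pm o(1))np$; (T2) $e(G\cap\mathrm{int}(S))=e(\mathrm{int}(S))p\pm o(n^2p)$ and $e(G\cap\mathrm{ext}(S))=e(\mathrm{ext}(S))p\pm o(n^2p)$ for every family $S$ of pairwise disjoint vertex sets; (T3) with $\mathcal H$ (resp. $\mathcal H_v$) the family of copies of $H$ in $K_n$ (resp. those containing $v$), for every edge $e$ of $K_n$ there are at most $4e_H^2n^{v_H-2}p^{e_H-2}$ graphs $A\setminus\{e,f\}\subseteq G$ with $A\in\mathcal H$ and distinct $e,f\in A$, and for every vertex $v$ there are at most $2v_He_Hn^{v_H-1}p^{e_H-1}$ graphs $A\setminus\{f\}\subseteq G$ with $f\in A\in\mathcal H_v$; (T4) $e(F\cap\mathrm{int}(\Pi))\le\beta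 n^2p$ for every largest $H$-free $F\subseteq G$ and every $r$-cut $\Pi$ that maximises $e(F\cap\mathrm{ext}(\Pi))$ and, subject to this, $e(F[V_1])$, where $\beta=\beta(n)\to0$; (T5) $|V^k(Q)|\ge c\min\{n,k(Q)np\}$ for all $k$ and all $Q\subseteq G$ of type (H); (T6) for all $Q\subseteq G$ of type (H) and all $(\ell_1,\dots,\ell_r)\in\mathbb N^r$ with $1\le\ell:=\sum_k\ell_k<v_H$ there is a family $\mathcal G$ of $\ell$-sets of vertices, each of which has, for some centre vertex $v$ of $Q$, exactly $\ell_k$ elements in $N_Q(v)\cap V^k(Q)$ for every $k$, such that $|\mathcal G|\ge c_\ell\min\{n^\ell,k(Q)(np)^\ell\}$ and, for $0\le j\le\ell$, every $j$-set of vertices is contained in at most $\max\{4(np)^{\ell-j},C_\ell|\mathcal G|/n^j\}$ members of $\mathcal G$; (T7) if $p>1/(10r^3)$, then $e(G\cap\mathrm{ext}(\{A,B\}))=(1\pm o(1))|A||B|p$ for all disjoint $A,B$ with $|A||B|\gg n$. Here the functions implicit in $o(\cdot)$ and $\gg$, the function $\beta$ and the constants $c,c_\ell>0$, $C_\ell\ge1$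 are fixed arbitrarily in advance. **Statement.** There is a constant $Z>0$ that depends only on $\alpha,p_0,r$ such that the following holds for every constant $K>0$ and all sufficiently large $n$. Let $Q\in\mathcal Q$, let $d,D,m,x$ be nonnegative integers with $D\ge1$, let $\mathcal F$ be a family of subgraphs of $K_n\setminus Q$, and suppose that $$d,\ e(Q)\ll n^2p\qquad\text{and}\qquad d\le v_{\min}(Q)\cdot\min\Big\{np,\ \frac{\delta}{2r^3}n\Big\}.$$ For a graph $G$, let $\mathcal F[G]=\{\omega\in\mathcal F:\omega\subseteq G\}$, let $\nu(\cdot)$ be the largest number of pairwise edge-disjoint members of a family, and let $|\partial\mathcal F[G]|$ be the number of pairs $(e,A)$, where $e$ is an edge of $K_n$ and $A\subseteq G$ is a graph with $A=\omega\setminus\{e\}$ for some $\omega\in\mathcal F$ containing $e$. Put $$\xi=\Pr\Big(G_{n,p}\text{ is }\mathcal C_Q\text{-rigid and }\nu\big(\mathcal F[G_{n,p}\cap\mathrm{ext}(\mathrm{core}_{\mathcal C_Q}(G_{n,p}))]\big)\le x+m+r^2(d+1)\ \Big|\ Q\subseteq G_{n,p}\Big).$$ Then the probability that $G_{n,p}\in\mathcal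 T$, $Q\subseteq G_{n,p}$, $\min\{\binom n2,|\partial\mathcal F[G_{n,p}]|\}\le Dm/p$, and some cut $\Pi\in\mathcal C_Q$ has deficit at most $d$ in $G_{n,p}$ and satisfies $\nu(\mathcal F[G_{n,p}\cap\mathrm{ext}(\Pi)])\le x$, is at most $$p^{e(Q)}\cdot D^d\cdot\Big(Z^d\,\xi+e^{-Kd\log(n^2p/d)}\Big),$$ where $d\log(n^2p/d)$ is $0$ for $d=0$. (The bounds $\ll$ in the hypotheses and $k(Q)=o(n)$ are with respect to rates fixed in advance; the threshold for $n$ may depend on these and on all other fixed data, but not on $Q,d,D,m,x,\mathcal F$.) -/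

import Mathlib

open Filter Topology

noncomputable section

namespace RandomTuran

/-! ## Graphs, tuples of vertex sets, hypergraphs of graphs -/

/-- The number of edges `e(G)`. -/
def edgeCount {V : Type*} (G : SimpleGraph V) : ℕ := G.edgeSet.ncard

/-- The external pairs of a family of pairwise disjoint vertex sets: the pairs of vertices that meet
two distinct members of the family. -/
def extGraph {V ι : Type*} (S : ι → Set V) : SimpleGraph V where
  Adj u v := u ≠ v ∧ ∃ i j, i ≠ j ∧ u ∈ S i ∧ v ∈ S j
  symm := ⟨fun _ _ ⟨h, i, j, hij, hu, hv⟩ => ⟨h.symm, j, i, hij.symm, hv, hu⟩⟩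
  loopless := ⟨fun _ h => h.1 rfl⟩

/-- The internal pairs of a family of pairwise disjoint vertex sets: the pairs of vertices contained
in a single member of the family. -/
def intGraph {V ι : Type*} (S : ι → Set V) : SimpleGraph V where
  Adj u v := u ≠ v ∧ ∃ i, u ∈ S i ∧ v ∈ S i
  symm := ⟨fun _ _ ⟨h, i, hu, hv⟩ => ⟨h.symm, i, hv, hu⟩⟩
  loopless := ⟨fun _ h => h.1 rfl⟩

/-- The degree of a vertex (as a cardinality that needs no decidability). -/
def deg {V : Type*} (G : SimpleGraph V) (v : V) : ℕ := (G.neighborSet v).ncard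

/-- Graphs on `V` are sets of edges of the complete graph, so a family of graphs is a hypergraph whose
vertices are the edges of the complete graph. `induced 𝓕 G` is the hypergraph `𝓕[G]`. -/
def induced {V : Type*} (𝓕 : Set (SimpleGraph V)) (G : SimpleGraph V) : Set (SimpleGraph V) :=
  {ω ∈ 𝓕 | ω ≤ G}

/-- The matching number: the largest size of a collection of pairwise (edge-)disjoint members. -/
def matchingNumber {V : Type*} (𝓕 : Set (SimpleGraph V)) : ℕ :=
  sSup {k | ∃ M ⊆ 𝓕, M.PairwiseDisjoint id ∧ M.ncard = k}

/-- The link hypergraph `∂ₑ𝓕 = {ω \ e : e ∈ ω ∈ 𝓕}`. -/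
def link {V : Type*} (e : Sym2 V) (𝓕 : Set (SimpleGraph V)) : Set (SimpleGraph V) :=
  {A | ∃ ω ∈ 𝓕, e ∈ ω.edgeSet ∧ A = ω.deleteEdges {e}}

/-- The union of all link hypergraphs, as a set. -/
def boundary {V : Type*} (𝓕 : Set (SimpleGraph V)) : Set (SimpleGraph V) := ⋃ e, link e 𝓕

/-- The number of members of all link hypergraphs that are contained in `G`, each of them counted once
for every edge `e` in whose link it lies: `∑ₑ |∂ₑ𝓕[G]|`. -/
def linkCount {V : Type*} [Fintype V] [DecidableEq V] (𝓕 : Set (SimpleGraph V))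
    (G : SimpleGraph V) : ℕ :=
  ∑ e : Sym2 V, (induced (link e 𝓕) G).ncard

/-! ## The forbidden graph and the threshold -/

/-- `χ(H \ e) < χ(H)` for some edge `e` of `H`. -/
def IsEdgeCritical {W : Type*} (H : SimpleGraph W) : Prop :=
  ∃ e ∈ H.edgeSet, (H.deleteEdges {e}).chromaticNumber < H.chromaticNumber

/-- `(e_F - 1) / (v_F - 2)`. -/
def subgraphDensity {W : Type*} {H : SimpleGraph W} (F : H.Subgraph) : ℝ :=
  ((F.edgeSet.ncard : ℝ) - 1) / ((F.verts.ncard : ℝ) - 2)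

/-- The 2-density `m₂(H)`. -/
def twoDensity {W : Type*} (H : SimpleGraph W) : ℝ :=
  ⨆ F : {F : H.Subgraph // 2 ≤ F.edgeSet.ncard}, subgraphDensity F.1

/-- The maximum in the definition of `m₂(H)` is attained at `H` and nowhere else. -/
def IsStrictlyTwoBalanced {W : Type*} (H : SimpleGraph W) : Prop :=
  2 ≤ edgeCount H ∧
    ∀ F : H.Subgraph, 2 ≤ F.edgeSet.ncard → F ≠ ⊤ →
      subgraphDensity F < subgraphDensity (⊤ : H.Subgraph)

/-- `K_r(m)⁺`: the complete `r`-partite graph with parts of size `m`, together with one edge (between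
the first two vertices of the first part). -/
def blowupPlus (r m : ℕ) : SimpleGraph (Fin r × Fin m) where
  Adj x y := x.1 ≠ y.1 ∨ (x.1.val = 0 ∧ y.1.val = 0 ∧ x.2.val + y.2.val = 1)
  symm := ⟨fun _ _ h => h.imp Ne.symm fun ⟨h₁, h₂, h₃⟩ => ⟨h₂, h₁, by omega⟩⟩
  loopless := ⟨fun _ h => h.elim (fun h => h rfl) fun ⟨_, _, h₃⟩ => by omega⟩

/-- `π_H = lim_m N(H, K_r(m)⁺) / m ^ (v_H - 2)`, for `r = χ(H) - 1`. -/
def piConst {h : ℕ} (r : ℕ) (H : SimpleGraph (Fin h)) : ℝ :=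
  limUnder atTop fun m : ℕ => ((blowupPlus r m).copyCount H : ℝ) / (m : ℝ) ^ (h - 2)

/-- The solution `θ_H > 0` of `r ^ (2 - v_H) * π_H * θ_H ^ (e_H - 1) = 2 - 1 / m₂(H)`, for
`r = χ(H) - 1`. -/
def thetaConst {h : ℕ} (r : ℕ) (H : SimpleGraph (Fin h)) : ℝ :=
  ((2 - 1 / twoDensity H) * (r : ℝ) ^ (h - 2) / piConst r H) ^ (1 / ((edgeCount H : ℝ) - 1))

/-- `p_H(n) = θ_H * n ^ (-1 / m₂(H)) * (log n) ^ (1 / (e_H - 1))`. -/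
def pThreshold {h : ℕ} (r : ℕ) (H : SimpleGraph (Fin h)) (n : ℕ) : ℝ :=
  thetaConst r H * (n : ℝ) ^ (-(1 / twoDensity H)) *
    Real.log n ^ (1 / ((edgeCount H : ℝ) - 1))

/-- All copies of `H` in `K_n` (for `H` without isolated vertices a copy is determined by its edges). -/
def copies {h : ℕ} (H : SimpleGraph (Fin h)) (n : ℕ) : Set (SimpleGraph (Fin n)) :=
  {A | ∃ φ : Fin h ↪ Fin n, A = H.map φ}

/-- All copies of `H` in `K_n` that contain the vertex `v`. -/
def copiesAt {h n : ℕ} (H : SimpleGraph (Fin h)) (v : Fin n) : Set (SimpleGraph (Fin n)) :=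
  {A | ∃ φ : Fin h ↪ Fin n, v ∈ Set.range φ ∧ A = H.map φ}

/-! ## Cuts -/

/-- An `r`-cut of the vertices of `K_n`, i.e. an ordered partition into `r` (possibly empty) parts; it
is given by the function that maps each vertex to the index of its part. -/
abbrev Cut (n r : ℕ) := Fin n → Fin r

/-- The `i`-th part of a cut. -/
def Cut.part {n r : ℕ} (P : Cut n r) (i : Fin r) : Set (Fin n) := {v | P v = i}

/-- The pairs crossing a cut. -/
def Cut.ext {n r : ℕ} (P : Cut n r) : SimpleGraph (Fin n) := extGraph P.part

/-- The pairs contained in a single part of a cut. -/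
def Cut.int {n r : ℕ} (P : Cut n r) : SimpleGraph (Fin n) := intGraph P.part

/-- Each part has size `(1 ± δ) n / r`. -/
def Cut.IsBalanced {n r : ℕ} (δ : ℝ) (P : Cut n r) : Prop :=
  ∀ i, (1 - δ) * (n / r) ≤ (P.part i).ncard ∧ ((P.part i).ncard : ℝ) ≤ (1 + δ) * (n / r)

/-- `b_𝓒(G)`: the largest number of edges of `G` that cross some cut in `𝓒`. -/
def maxCutSize {n r : ℕ} (𝓒 : Set (Cut n r)) (G : SimpleGraph (Fin n)) : ℕ :=
  sSup ((fun P : Cut n r => edgeCount (G ⊓ P.ext)) '' 𝓒)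

/-- The deficit of a cut `P ∈ 𝓒` (for such cuts the subtraction never truncates). -/
def deficit {n r : ℕ} (𝓒 : Set (Cut n r)) (G : SimpleGraph (Fin n)) (P : Cut n r) : ℕ :=
  maxCutSize 𝓒 G - edgeCount (G ⊓ P.ext)

/-- The cuts of `𝓒` crossed by the largest number of edges of `G`. -/
def maxCuts {n r : ℕ} (𝓒 : Set (Cut n r)) (G : SimpleGraph (Fin n)) : Set (Cut n r) :=
  {P ∈ 𝓒 | edgeCount (G ⊓ P.ext) = maxCutSize 𝓒 G}

/-- Two vertices are equivalent if they are in the same part of every maximum cut. -/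
def cutSetoid {n r : ℕ} (𝓒 : Set (Cut n r)) (G : SimpleGraph (Fin n)) : Setoid (Fin n) where
  r u v := ∀ P ∈ maxCuts 𝓒 G, P u = P v
  iseqv := ⟨fun _ _ _ => rfl, fun h P hP => (h P hP).symm,
    fun h₁ h₂ P hP => (h₁ P hP).trans (h₂ P hP)⟩

/-- The `(𝓒, G)`-components, i.e. the equivalence classes. -/
def components {n r : ℕ} (𝓒 : Set (Cut n r)) (G : SimpleGraph (Fin n)) : Set (Set (Fin n)) :=
  (cutSetoid 𝓒 G).classes

/-- `G` is `𝓒`-rigid: there are at least `(1 - α) n² / (2r)` pairs of equivalent vertices. -/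
def IsRigid {n r : ℕ} (α : ℝ) (𝓒 : Set (Cut n r)) (G : SimpleGraph (Fin n)) : Prop :=
  (1 - α) * (n : ℝ) ^ 2 / (2 * r) ≤
    edgeCount (intGraph fun S : components 𝓒 G => (S : Set (Fin n)))

/-- The core of a rigid graph: the collection of components of size greater than `(1 - 4rα) n / r`. -/
def core {n r : ℕ} (α : ℝ) (𝓒 : Set (Cut n r)) (G : SimpleGraph (Fin n)) : Set (Set (Fin n)) :=
  {S ∈ components 𝓒 G | (1 - 4 * r * α) * (n / r) < S.ncard}

/-- The pairs of vertices meeting two distinct elements of the core. -/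
def coreExt {n r : ℕ} (α : ℝ) (𝓒 : Set (Cut n r)) (G : SimpleGraph (Fin n)) :
    SimpleGraph (Fin n) :=
  extGraph fun S : core α 𝓒 G => (S : Set (Fin n))

/-! ## The coloured graphs `Q` -/

/-- An `[r]`-coloured subgraph of `K_n`. Its vertices are the endpoints of its edges; the values of
`colour` at other vertices play no role. Colour `1` of the usual palette `{1, …, r}` is `0 : Fin r`. -/
structure ColouredGraph (n r : ℕ) where
  graph : SimpleGraph (Fin n)
  colour : Fin n → Fin r

namespace ColouredGraph

variable {n r : ℕ} (Q : ColouredGraph n r)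

/-- `V^k(Q)`, the vertices of colour `k`. -/
def colourClass (k : Fin r) : Set (Fin n) := {v ∈ Q.graph.support | Q.colour v = k}

/-- The minimum size of a nonempty colour class (`⊤` if there is none, i.e. if `Q` is empty). -/
def vMin : ℕ∞ := ⨅ k : {k : Fin r // (Q.colourClass k).Nonempty}, (Q.colourClass k.1).encard

/-- The cut is compatible with `Q`: the vertices of colour `k` are in the `k`-th part. -/
def IsCompatible (P : Cut n r) : Prop := ∀ k, Q.colourClass k ⊆ P.part k

/-- `𝓒_Q`: all `δ`-balanced `r`-cuts that are compatible with `Q`. -/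
def cuts (δ : ℝ) : Set (Cut n r) := {P | P.IsBalanced δ ∧ Q.IsCompatible P}

/-- `𝓠_L`: maximum degree at most `κnp / log n` and all vertices coloured `1`. -/
def IsLow (κ p : ℝ) : Prop :=
  (∀ v, (deg Q.graph v : ℝ) ≤ κ * n * p / Real.log n) ∧
    ∀ v ∈ Q.graph.support, (Q.colour v).val = 0

/-- `Q ∈ 𝓠_H` with the set `X` of centre vertices: `X` is an independent set of at most `s` vertices of
colour `1` that dominates all edges, and every vertex in `X` has exactly `⌈ηnp⌉` neighbours in each
colour class. (If `ηnp > 0`, then `X` is determined by `Q`.) -/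
structure IsHighWith (η p s : ℝ) (X : Set (Fin n)) : Prop where
  subset : ∀ v ∈ X, v ∈ Q.graph.support ∧ (Q.colour v).val = 0
  indep : ∀ u ∈ X, ∀ v ∈ X, ¬ Q.graph.Adj u v
  card_le : (X.ncard : ℝ) ≤ s
  dominates : ∀ u v, Q.graph.Adj u v → u ∈ X ∨ v ∈ X
  degrees : ∀ v ∈ X, ∀ k,
    (Q.graph.neighborSet v ∩ Q.colourClass k).ncard = ⌈η * n * p⌉₊

/-- The sets `U` of `ℓ₁ + ⋯ + ℓ_r` vertices that contain exactly `ℓ_k` neighbours of `v` of colour `k`,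
for every `k`. -/
def nbhdSets (l : Fin r → ℕ) (v : Fin n) : Set (Finset (Fin n)) :=
  {U | U.card = ∑ k, l k ∧
    ∀ k, ((U : Set (Fin n)) ∩ Q.graph.neighborSet v ∩ Q.colourClass k).ncard = l k}

/-- `𝓑_{Q,𝓕}(d, x)`: the graphs `G ⊇ Q` that admit a cut in `𝓒_Q` of deficit at most `d` such that the
matching number of `𝓕[G ∩ ext(P)]` is at most `x`. -/
def bad (δ : ℝ) (𝓕 : Set (SimpleGraph (Fin n))) (d x : ℕ) : Set (SimpleGraph (Fin n)) :=
  {G | Q.graph ≤ G ∧ ∃ P ∈ Q.cuts δ, deficit (Q.cuts δ) G P ≤ d ∧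
    matchingNumber (induced 𝓕 (G ⊓ P.ext)) ≤ x}

end ColouredGraph

/-! ## Typical graphs -/

/-- `F` is a largest `H`-free subgraph of `G`. -/
def IsLargestFree {h n : ℕ} (H : SimpleGraph (Fin h)) (G F : SimpleGraph (Fin n)) : Prop :=
  F ≤ G ∧ H.Free F ∧ ∀ F' ≤ G, H.Free F' → edgeCount F' ≤ edgeCount F

/-- `P` maximises `e(F ∩ ext(P))` over all `r`-cuts and, among all such maximisers, it has the largest
number of edges of `F` inside the first part. -/
def IsCanonicalCut {n r : ℕ} (F : SimpleGraph (Fin n)) (P : Cut n r) : Prop :=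
  (∀ P' : Cut n r, edgeCount (F ⊓ P'.ext) ≤ edgeCount (F ⊓ P.ext)) ∧
    ∀ P' : Cut n r, edgeCount (F ⊓ P'.ext) = edgeCount (F ⊓ P.ext) →
      ∀ i : Fin r, i.val = 0 →
        edgeCount (F ⊓ intGraph fun _ : Unit => P'.part i) ≤
          edgeCount (F ⊓ intGraph fun _ : Unit => P.part i)

/-- The implicit functions and constants in the definition of a typical graph. -/
structure Tolerances where
  /-- bounds `e(F ∩ int(P_F)) / (n²p)` for largest `H`-free subgraphs `F` -/
  β : ℕ → ℝ
  /-- the error term `o(1)` in the conditions on degrees and edge distribution -/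
  ρ : ℕ → ℝ
  /-- the `o(n)` bound on the number of centre vertices is `σ n * n` -/
  σ : ℕ → ℝ
  /-- `|A||B| ≫ n` is read as `ω n * n ≤ |A||B|` -/
  ω : ℕ → ℝ
  /-- the constant in the lower bound on the colour classes of high-degree graphs -/
  c : ℝ
  /-- the lower constant for neighbourhood hypergraphs with edges of size `ℓ` -/
  cN : ℕ → ℝ
  /-- the upper constant for neighbourhood hypergraphs with edges of size `ℓ` -/
  CN : ℕ → ℝ

/-- The implicit functions have the required limits, the implicit constants have the required signs. -/
structure Tolerances.Admissible (t : Tolerances) : Prop where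
  β : Tendsto t.β atTop (𝓝 0)
  ρ : Tendsto t.ρ atTop (𝓝 0)
  σ : Tendsto t.σ atTop (𝓝 0)
  ω : Tendsto t.ω atTop atTop
  c : 0 < t.c
  cN : ∀ l, 0 < t.cN l
  CN : ∀ l, 1 ≤ t.CN l

/-- Membership in the family `𝓠 = 𝓠_L ∪ 𝓠_H`. -/
def ColouredGraph.InFamily {n r : ℕ} (Q : ColouredGraph n r) (κ η p : ℝ) (t : Tolerances) : Prop :=
  Q.IsLow κ p ∨ ∃ X, Q.IsHighWith η p (t.σ n * n) X

/-- The event `𝓣`: the graph `G` on `n` vertices is typical (pseudo-random) for density `p`. -/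
structure IsTypical {h n : ℕ} (H : SimpleGraph (Fin h)) (r : ℕ) (η p : ℝ) (t : Tolerances)
    (G : SimpleGraph (Fin n)) : Prop where
  degrees : ∀ v, |(deg G v : ℝ) - n * p| ≤ t.ρ n * (n * p)
  edges : ∀ (k : ℕ) (V : Fin k → Set (Fin n)), Pairwise (fun i j => Disjoint (V i) (V j)) →
    |(edgeCount (G ⊓ intGraph V) : ℝ) - edgeCount (intGraph V) * p| ≤ t.ρ n * ((n : ℝ) ^ 2 * p) ∧
    |(edgeCount (G ⊓ extGraph V) : ℝ) - edgeCount (extGraph V) * p| ≤ t.ρ n * ((n : ℝ) ^ 2 * p)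
  copies_edge : ∀ e ∈ (⊤ : SimpleGraph (Fin n)).edgeSet,
    ((induced (boundary (link e (copies H n))) G).ncard : ℝ) ≤
      4 * (edgeCount H : ℝ) ^ 2 * (n : ℝ) ^ (h - 2) * p ^ (edgeCount H - 2)
  copies_vertex : ∀ v : Fin n,
    ((induced (boundary (copiesAt H v)) G).ncard : ℝ) ≤
      2 * h * edgeCount H * (n : ℝ) ^ (h - 1) * p ^ (edgeCount H - 1)
  stability : ∀ F, IsLargestFree H G F → ∀ P : Cut n r, IsCanonicalCut F P →
    (edgeCount (F ⊓ P.int) : ℝ) ≤ t.β n * ((n : ℝ) ^ 2 * p)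
  high_classes : ∀ (Q : ColouredGraph n r) (X : Set (Fin n)),
    Q.IsHighWith η p (t.σ n * n) X → Q.graph ≤ G →
      ∀ k, t.c * min (n : ℝ) (X.ncard * (n * p)) ≤ (Q.colourClass k).ncard
  high_neighbourhoods : ∀ (l : Fin r → ℕ), 1 ≤ ∑ k, l k → ∑ k, l k < h →
    ∀ (Q : ColouredGraph n r) (X : Set (Fin n)),
    Q.IsHighWith η p (t.σ n * n) X → Q.graph ≤ G →
      ∃ 𝓖 : Finset (Finset (Fin n)),
        (∀ U ∈ 𝓖, ∃ v ∈ X, U ∈ Q.nbhdSets l v) ∧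
        t.cN (∑ k, l k) * min ((n : ℝ) ^ (∑ k, l k)) (X.ncard * (n * p) ^ (∑ k, l k)) ≤ 𝓖.card ∧
        ∀ T : Finset (Fin n), T.card ≤ ∑ k, l k →
          ((𝓖.filter fun U => T ⊆ U).card : ℝ) ≤
            max (4 * (n * p) ^ ((∑ k, l k) - T.card))
              (t.CN (∑ k, l k) * 𝓖.card / (n : ℝ) ^ T.card)
  dense_pairs : 1 / (10 * (r : ℝ) ^ 3) < p → ∀ A B : Set (Fin n), Disjoint A B →
    t.ω n * n ≤ (A.ncard : ℝ) * B.ncard →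
      |(edgeCount (G ⊓ extGraph ![A, B]) : ℝ) - edgeCount (extGraph ![A, B]) * p| ≤
        t.ρ n * (edgeCount (extGraph ![A, B]) * p)

/-! ## The conditional probability `ξ` -/

/-- The probability that `G_{n,p}` is `𝓒_Q`-rigid and that the matching number of
`𝓕[G_{n,p} ∩ ext(core)]` is at most `y`, conditioned on `Q ⊆ G_{n,p}`. -/
def coreProb {n r : ℕ} (p : unitInterval) (α δ : ℝ) (Q : ColouredGraph n r)
    (𝓕 : Set (SimpleGraph (Fin n))) (y : ℕ) : ℝ :=
  (ProbabilityTheory.cond (SimpleGraph.binomialRandom (Fin n) p) {G | Q.graph ≤ G}).real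
    {G | IsRigid α (Q.cuts δ) G ∧
      matchingNumber (induced 𝓕 (G ⊓ coreExt α (Q.cuts δ) G)) ≤ y}

end RandomTuran

end

/-!
Write `μ` for the law of the binomial random graph and `b` for the size of a maximum cut in `𝓒_Q`. For
`d = 0` the exponential term is `1`, and the bound is the probability of `Q ⊆ G`. For `d ≥ 1` the proof
deletes edges one at a time from a typical graph `G` with a cut `Π` of deficit at most `d`. The deleted
edges always lie inside the parts of `Π` and outside `Q`, so `e(G ∩ ext(Π))` does not change, the deficit
of `Π` never grows, and the matching number of `𝓕[G ∩ ext(Π)]` stays at most `x`. Since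
`(1 - p) μ(G) = p μ(G \ e)`, a deletion with many choices that can be undone in few ways bounds the
probability of a family of graphs by that of the next one (`switching`). There are two kinds of steps.

* `G` is rigid. If the matching number of `𝓕` across the core is at most `x + m + r²(d + 1)`, then `G` is
  one of the graphs counted by `ξ`, and the chain stops. Otherwise more than `m` edges of `G` cross the
  core, lie inside the parts of `Π` and have a nonempty link in `𝓕[G]`
  (`le_ncard_of_matchingNumber_lt`). Two members of the core are too large to share a part of a balanced
  cut, so these edges cross all maximum cuts (`coreExt_le_ext`), and deleting one of them lowers `b`, and
  with it the deficit of `Π`. As at most `Dm/p` edges have a nonempty link, the step costs a factor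
  `D / (1 - p)` (`rigid_recursion`), and it happens at most `d` times.
* `G` is not rigid. An arbitrary edge of `G \ Q` inside the parts of `Π` is deleted; there are at least
  `(1 - o(1)) n²p / (2r)` choices. If the ends of the edge are inequivalent in `G \ e`, then the deficit of
  `Π` has dropped. If they are equivalent and `G \ e` is not rigid either, then there are at most
  `(1 - α + o(1)) (1 - p) n² / (2r)` ways to undo the step, a gain of a factor `1 - α / 2`. In the remaining
  case the factor is bounded, and the next step is of the first kind (`nonrigid_recursion`).

The resulting recursion (`recursion_bound`) bounds the probability after `N` steps by
`(Z D)^d` times the sum of the probability of the good graphs and of `p ^ e(Q) (1 - α / 4) ^ N`. With `N` a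
large multiple of `d log(n²p / d)` the second term is the required error term, and as `d` is of smaller
order than `n²p`, so is `N`; hence all graphs of the chain inherit the edge distribution of `G`.
-/

noncomputable section

namespace RandomTuran

open MeasureTheory

/-! ### Switching edges in the binomial random graph -/

lemma measurableSet_graphs {n : ℕ} (A : Set (SimpleGraph (Fin n))) : MeasurableSet A := by
  rw [← SimpleGraph.measurableEmbedding_edgeSet.measurableSet_image]
  exact (Set.toFinite _).measurableSet

instance {n : ℕ} : MeasurableSingletonClass (SimpleGraph (Fin n)) :=
  ⟨fun _ => measurableSet_graphs _⟩

lemma real_singleton {n : ℕ} (p : unitInterval) (G : SimpleGraph (Fin n)) :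
    (SimpleGraph.binomialRandom (Fin n) p).real {G} =
      (p : ℝ) ^ G.edgeSet.ncard * (1 - (p : ℝ)) ^ (n.choose 2 - G.edgeSet.ncard) := by
  simp [measureReal_def]

open Classical in
lemma real_eq_sum {n : ℕ} (p : unitInterval) (A : Set (SimpleGraph (Fin n))) :
    (SimpleGraph.binomialRandom (Fin n) p).real A =
      ∑ G ∈ A.toFinset, (SimpleGraph.binomialRandom (Fin n) p).real {G} := by
  rw [sum_measureReal_singleton, Set.coe_toFinset]

lemma ncard_edgeSet_le {n : ℕ} (G : SimpleGraph (Fin n)) : G.edgeSet.ncard ≤ n.choose 2 := by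
  classical
  rw [← SimpleGraph.coe_edgeFinset, Set.ncard_coe_finset]
  simpa using G.card_edgeFinset_le_card_choose_two

lemma ncard_deleteEdges {n : ℕ} {G : SimpleGraph (Fin n)} {e : Sym2 (Fin n)} (he : e ∈ G.edgeSet) :
    (G.deleteEdges {e}).edgeSet.ncard + 1 = G.edgeSet.ncard := by
  rw [SimpleGraph.edgeSet_deleteEdges]
  exact Set.ncard_sdiff_singleton_add_one he (Set.toFinite _)

/-- Deleting one edge changes the probability of a graph by the factor `(1 - p) / p`. -/
lemma real_singleton_deleteEdges {n : ℕ} (p : unitInterval) {G : SimpleGraph (Fin n)}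
    {e : Sym2 (Fin n)} (he : e ∈ G.edgeSet) :
    (1 - (p : ℝ)) * (SimpleGraph.binomialRandom (Fin n) p).real {G} =
      p * (SimpleGraph.binomialRandom (Fin n) p).real {G.deleteEdges {e}} := by
  have h1 := ncard_deleteEdges he
  have h2 := ncard_edgeSet_le G
  rw [real_singleton, real_singleton, ← h1]
  have h3 : n.choose 2 - (G.deleteEdges {e}).edgeSet.ncard =
      n.choose 2 - ((G.deleteEdges {e}).edgeSet.ncard + 1) + 1 := by omega
  rw [h3]
  ring

lemma sum_biUnion_le {ι κ : Type*} [DecidableEq κ] (S : Finset ι) (T : ι → Finset κ) (f : κ → ℝ)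
    (hf : ∀ x, 0 ≤ f x) : ∑ x ∈ S.biUnion T, f x ≤ ∑ i ∈ S, ∑ x ∈ T i, f x := by
  classical
  induction S using Finset.induction_on with
  | empty => simp
  | insert i S hi ih =>
    rw [Finset.biUnion_insert, Finset.sum_insert hi]
    have h1 := Finset.sum_union_inter (s₁ := T i) (s₂ := S.biUnion T) (f := f)
    have h2 : 0 ≤ ∑ x ∈ T i ∩ S.biUnion T, f x := Finset.sum_nonneg fun x _ => hf x
    linarith

/-- A switching inequality: if every graph in `𝒜` has at least `a` edges `e ∈ c G` whose deletion leads
to one of the families `ℬ i`, and every graph in `ℬ i` is reached through at most `R i` pairs, then the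
probabilities of `𝒜` and of the `ℬ i` are related by double counting. -/
lemma switching {n : ℕ} (p : unitInterval) {ι : Type*} [Fintype ι]
    (𝒜 : Set (SimpleGraph (Fin n))) (ℬ : ι → Set (SimpleGraph (Fin n)))
    (c : SimpleGraph (Fin n) → Set (Sym2 (Fin n)))
    (s : ι → SimpleGraph (Fin n) → Set (Sym2 (Fin n))) (a : ℝ) (R : ι → ℝ)
    (hc : ∀ G ∈ 𝒜, c G ⊆ G.edgeSet) (ha : ∀ G ∈ 𝒜, a ≤ (c G).ncard)
    (hR : ∀ i, ∀ G ∈ ℬ i, (((s i G).ncard : ℕ) : ℝ) ≤ R i)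
    (hstep : ∀ G ∈ 𝒜, ∀ e ∈ c G, ∃ i, G.deleteEdges {e} ∈ ℬ i ∧ e ∈ s i (G.deleteEdges {e})) :
    (1 - (p : ℝ)) * (a * (SimpleGraph.binomialRandom (Fin n) p).real 𝒜) ≤
      p * ∑ i, R i * (SimpleGraph.binomialRandom (Fin n) p).real (ℬ i) := by
  classical
  set w : SimpleGraph (Fin n) → ℝ := fun G => (SimpleGraph.binomialRandom (Fin n) p).real {G} with hw
  have hw0 : ∀ G, 0 ≤ w G := fun G => measureReal_nonneg
  have hp0 : (0 : ℝ) ≤ p := p.2.1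
  have hp1 : (0 : ℝ) ≤ 1 - p := by linarith [p.2.2]
  have step1 : a * (SimpleGraph.binomialRandom (Fin n) p).real 𝒜 ≤
      ∑ G ∈ 𝒜.toFinset, ∑ e ∈ (c G).toFinset, w G := by
    rw [real_eq_sum, Finset.mul_sum]
    refine Finset.sum_le_sum fun G hG => ?_
    rw [Finset.sum_const, nsmul_eq_mul, ← Set.ncard_eq_toFinset_card']
    exact mul_le_mul_of_nonneg_right (ha G (by simpa using hG)) (hw0 G)
  have step2 : (1 - (p : ℝ)) * ∑ G ∈ 𝒜.toFinset, ∑ e ∈ (c G).toFinset, w G =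
      p * ∑ x ∈ 𝒜.toFinset.sigma fun G => (c G).toFinset, w (x.1.deleteEdges {x.2}) := by
    rw [Finset.sum_sigma, Finset.mul_sum, Finset.mul_sum]
    refine Finset.sum_congr rfl fun G hG => ?_
    rw [Finset.mul_sum, Finset.mul_sum]
    refine Finset.sum_congr rfl fun e he => ?_
    exact real_singleton_deleteEdges p (hc G (by simpa using hG) (by simpa using he))
  have step3 : ∑ x ∈ 𝒜.toFinset.sigma fun G => (c G).toFinset, w (x.1.deleteEdges {x.2}) ≤
      ∑ i, ∑ G ∈ (ℬ i).toFinset, ∑ e ∈ (s i G).toFinset, w G := by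
    have hinj : Set.InjOn (fun x : (_ : SimpleGraph (Fin n)) × Sym2 (Fin n) =>
        (x.1.deleteEdges {x.2}, x.2)) (𝒜.toFinset.sigma fun G => (c G).toFinset) := by
      rintro ⟨G, e⟩ hx ⟨G', e'⟩ hx' h
      simp only [Finset.coe_sigma, Set.mem_sigma_iff, Finset.mem_coe, Set.mem_toFinset] at hx hx'
      simp only [Prod.mk.injEq] at h
      obtain ⟨h1, rfl⟩ := h
      have h2 := congrArg SimpleGraph.edgeSet h1
      rw [SimpleGraph.edgeSet_deleteEdges, SimpleGraph.edgeSet_deleteEdges] at h2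
      have h3 : G.edgeSet = G'.edgeSet := by
        rw [← Set.insert_sdiff_self_of_mem (hc G hx.1 hx.2),
          ← Set.insert_sdiff_self_of_mem (hc G' hx'.1 hx'.2), h2]
      rw [SimpleGraph.edgeSet_injective h3]
    rw [← Finset.sum_image (s := 𝒜.toFinset.sigma fun G => (c G).toFinset)
      (f := fun y : SimpleGraph (Fin n) × Sym2 (Fin n) => w y.1) hinj]
    have hsub : (𝒜.toFinset.sigma fun G => (c G).toFinset).image (fun x => (x.1.deleteEdges {x.2}, x.2))
        ⊆ Finset.univ.biUnion fun i => ((ℬ i).toFinset.sigma fun G => (s i G).toFinset).image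
          fun x => (x.1, x.2) := by
      intro y hy
      obtain ⟨⟨G, e⟩, hx, rfl⟩ := Finset.mem_image.1 hy
      simp only [Finset.mem_sigma, Set.mem_toFinset] at hx
      obtain ⟨i, h1, h2⟩ := hstep G hx.1 e hx.2
      refine Finset.mem_biUnion.2 ⟨i, Finset.mem_univ _, Finset.mem_image.2 ⟨⟨_, e⟩, ?_, rfl⟩⟩
      simpa using ⟨h1, h2⟩
    refine (Finset.sum_le_sum_of_subset_of_nonneg hsub fun _ _ _ => hw0 _).trans ?_
    refine (sum_biUnion_le _ _ _ fun _ => hw0 _).trans ?_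
    refine Finset.sum_le_sum fun i _ => ?_
    rw [Finset.sum_image (by rintro ⟨_, _⟩ _ ⟨_, _⟩ _ h; simpa using h), Finset.sum_sigma]
  have step4 : ∑ i, ∑ G ∈ (ℬ i).toFinset, ∑ e ∈ (s i G).toFinset, w G ≤
      ∑ i, R i * (SimpleGraph.binomialRandom (Fin n) p).real (ℬ i) := by
    refine Finset.sum_le_sum fun i _ => ?_
    rw [real_eq_sum, Finset.mul_sum]
    refine Finset.sum_le_sum fun G hG => ?_
    rw [Finset.sum_const, nsmul_eq_mul, ← Set.ncard_eq_toFinset_card']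
    exact mul_le_mul_of_nonneg_right (hR i G (by simpa using hG)) (hw0 G)
  calc _ ≤ (1 - (p : ℝ)) * ∑ G ∈ 𝒜.toFinset, ∑ e ∈ (c G).toFinset, w G :=
        mul_le_mul_of_nonneg_left step1 hp1
    _ ≤ _ := by rw [step2]; exact mul_le_mul_of_nonneg_left (step3.trans step4) hp0

/-- The probability that the binomial random graph contains a fixed graph. -/
lemma real_superset {n : ℕ} (p : unitInterval) (Q : SimpleGraph (Fin n)) :
    (SimpleGraph.binomialRandom (Fin n) p).real {G | Q ≤ G} = (p : ℝ) ^ edgeCount Q := by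
  classical
  have hQ : Q.edgeFinset ⊆ (⊤ : SimpleGraph (Fin n)).edgeFinset :=
    SimpleGraph.edgeFinset_mono le_top
  set U := (⊤ : SimpleGraph (Fin n)).edgeFinset \ Q.edgeFinset with hU
  have hUc : U.card = n.choose 2 - Q.edgeFinset.card := by
    rw [hU, Finset.card_sdiff_of_subset hQ, SimpleGraph.card_edgeFinset_top_eq_card_choose_two,
      Fintype.card_fin]
  have hQc : Q.edgeFinset.card ≤ n.choose 2 := by
    simpa using Q.card_edgeFinset_le_card_choose_two
  have key : ∑ t ∈ U.powerset, (p : ℝ) ^ t.card * (1 - (p : ℝ)) ^ (U.card - t.card) = 1 := by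
    rw [Finset.sum_pow_mul_eq_add_pow]; simp
  have hec : edgeCount Q = Q.edgeFinset.card := by
    rw [edgeCount, ← SimpleGraph.coe_edgeFinset, Set.ncard_coe_finset]
  rw [real_eq_sum, hec, ← mul_one ((p : ℝ) ^ Q.edgeFinset.card), ← key, Finset.mul_sum]
  refine Finset.sum_nbij' (fun G => G.edgeFinset \ Q.edgeFinset)
    (fun t => SimpleGraph.fromEdgeSet (t ∪ Q.edgeFinset : Finset _)) ?_ ?_ ?_ ?_ ?_
  · intro G _
    rw [Finset.mem_powerset]
    exact Finset.sdiff_subset_sdiff (SimpleGraph.edgeFinset_mono le_top) le_rfl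
  · intro t _
    simp only [Set.mem_toFinset, Set.mem_ofPred_eq]
    rw [← SimpleGraph.fromEdgeSet_edgeSet Q]
    refine SimpleGraph.fromEdgeSet_mono ?_
    intro e he
    simpa using Or.inr he
  · intro G hG
    simp only [Set.mem_toFinset, Set.mem_ofPred_eq] at hG
    rw [Finset.sdiff_union_of_subset (SimpleGraph.edgeFinset_mono hG)]
    simp
  · intro t ht
    rw [Finset.mem_powerset, hU] at ht
    ext e
    have h1 := @ht e
    simp only [Finset.mem_sdiff, SimpleGraph.mem_edgeFinset, SimpleGraph.edgeSet_fromEdgeSet,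
      Set.mem_sdiff, Finset.mem_coe, Finset.mem_union] at h1 ⊢
    have h2 : e ∈ (⊤ : SimpleGraph (Fin n)).edgeSet → ¬ e ∈ Sym2.diagSet := by
      intro h; simpa using h
    tauto
  · intro G hG
    simp only [Set.mem_toFinset, Set.mem_ofPred_eq] at hG
    have h1 := SimpleGraph.edgeFinset_mono hG
    have h2 : G.edgeSet.ncard = G.edgeFinset.card := by
      rw [← SimpleGraph.coe_edgeFinset, Set.ncard_coe_finset]
    have h3 : G.edgeFinset.card ≤ n.choose 2 := by
      simpa using G.card_edgeFinset_le_card_choose_two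
    have h4 := Finset.card_sdiff_of_subset h1
    have h5 := Finset.card_le_card h1
    rw [real_singleton, h2, ← mul_assoc, ← pow_add, h4, hUc]
    congr 2 <;> omega

/-! ### Maximum cuts and deletion of one edge -/

section Deletion

variable {n r : ℕ}

lemma Cut.ext_adj {P : Cut n r} {u v : Fin n} : P.ext.Adj u v ↔ P u ≠ P v := by
  constructor
  · rintro ⟨_, i, j, hij, hu, hv⟩ h
    exact hij (hu.symm.trans (h.trans hv))
  · intro h
    exact ⟨fun huv => h (congrArg P huv), P u, P v, h, rfl, rfl⟩

lemma Cut.int_adj {P : Cut n r} {u v : Fin n} : P.int.Adj u v ↔ u ≠ v ∧ P u = P v := by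
  constructor
  · rintro ⟨h, i, hu, hv⟩
    exact ⟨h, Eq.trans hu (Eq.symm hv)⟩
  · rintro ⟨h, huv⟩
    exact ⟨h, P u, rfl, huv.symm⟩

lemma edgeCount_mono {G G' : SimpleGraph (Fin n)} (h : G ≤ G') : edgeCount G ≤ edgeCount G' :=
  Set.ncard_le_ncard (SimpleGraph.edgeSet_mono h) (Set.toFinite _)

lemma edgeCount_deleteEdges_inf_of_mem {G I : SimpleGraph (Fin n)} {e : Sym2 (Fin n)}
    (he : e ∈ G.edgeSet) (hI : e ∈ I.edgeSet) :
    edgeCount (G.deleteEdges {e} ⊓ I) + 1 = edgeCount (G ⊓ I) := by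
  have h : (G.deleteEdges {e} ⊓ I) = (G ⊓ I).deleteEdges {e} := by
    apply SimpleGraph.edgeSet_injective
    simp only [SimpleGraph.edgeSet_inf, SimpleGraph.edgeSet_deleteEdges]
    ext; simp; tauto
  rw [h]
  exact ncard_deleteEdges (by rw [SimpleGraph.edgeSet_inf]; exact ⟨he, hI⟩)

lemma edgeCount_deleteEdges_inf_of_notMem {G I : SimpleGraph (Fin n)} {e : Sym2 (Fin n)}
    (hI : e ∉ I.edgeSet) : edgeCount (G.deleteEdges {e} ⊓ I) = edgeCount (G ⊓ I) := by
  have h : (G.deleteEdges {e} ⊓ I) = G ⊓ I := by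
    apply SimpleGraph.edgeSet_injective
    simp only [SimpleGraph.edgeSet_inf, SimpleGraph.edgeSet_deleteEdges]
    ext f
    simp only [Set.mem_inter_iff, Set.mem_sdiff, Set.mem_singleton_iff]
    constructor
    · tauto
    · rintro ⟨h1, h2⟩
      exact ⟨⟨h1, fun hf => hI (hf ▸ h2)⟩, h2⟩
  rw [h]

variable {𝓒 : Set (Cut n r)} {G : SimpleGraph (Fin n)} {P : Cut n r}

lemma edgeCount_le_maxCutSize (hP : P ∈ 𝓒) : edgeCount (G ⊓ P.ext) ≤ maxCutSize 𝓒 G :=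
  le_csSup (Set.toFinite _).bddAbove ⟨P, hP, rfl⟩

lemma maxCutSize_le {b : ℕ} (hne : 𝓒.Nonempty) (h : ∀ P ∈ 𝓒, edgeCount (G ⊓ P.ext) ≤ b) :
    maxCutSize 𝓒 G ≤ b :=
  csSup_le (hne.image _) (by rintro _ ⟨P, hP, rfl⟩; exact h P hP)

/-- Deleting an edge that crosses all maximum cuts makes the maximum cut smaller. -/
lemma maxCutSize_deleteEdges_lt (hne : 𝓒.Nonempty) {e : Sym2 (Fin n)} (he : e ∈ G.edgeSet)
    (hcross : ∀ P ∈ maxCuts 𝓒 G, e ∈ P.ext.edgeSet) :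
    maxCutSize 𝓒 (G.deleteEdges {e}) + 1 ≤ maxCutSize 𝓒 G := by
  have key : ∀ P ∈ 𝓒, edgeCount (G.deleteEdges {e} ⊓ P.ext) + 1 ≤ maxCutSize 𝓒 G := by
    intro P hP
    have h1 : edgeCount (G ⊓ P.ext) ≤ maxCutSize 𝓒 G := edgeCount_le_maxCutSize hP
    by_cases hm : e ∈ P.ext.edgeSet
    · rwa [edgeCount_deleteEdges_inf_of_mem he hm]
    · rw [edgeCount_deleteEdges_inf_of_notMem hm]
      exact lt_of_le_of_ne h1 fun h => hm (hcross P ⟨hP, h⟩)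
  have h0 : 1 ≤ maxCutSize 𝓒 G := by
    obtain ⟨P, hP⟩ := hne
    exact le_trans (by omega) (key P hP)
  have := maxCutSize_le (G := G.deleteEdges {e}) (b := maxCutSize 𝓒 G - 1) hne
    fun P hP => by have := key P hP; omega
  omega

/-- The maximum cut grows when an edge between two inequivalent vertices is added. -/
lemma maxCutSize_deleteEdges_lt_of_maxCuts {e : Sym2 (Fin n)} (he : e ∈ G.edgeSet)
    (hP : P ∈ maxCuts 𝓒 (G.deleteEdges {e})) (hcross : e ∈ P.ext.edgeSet) :
    maxCutSize 𝓒 (G.deleteEdges {e}) + 1 ≤ maxCutSize 𝓒 G := by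
  rw [← hP.2, edgeCount_deleteEdges_inf_of_mem he hcross]
  exact edgeCount_le_maxCutSize hP.1

lemma maxCutSize_mono (hne : 𝓒.Nonempty) {G' : SimpleGraph (Fin n)} (h : G' ≤ G) :
    maxCutSize 𝓒 G' ≤ maxCutSize 𝓒 G :=
  maxCutSize_le hne fun _ hP =>
    (edgeCount_mono (inf_le_inf_right _ h)).trans (edgeCount_le_maxCutSize hP)

/-- The pairs of equivalent vertices, as a graph. -/
def eqvGraph (𝓒 : Set (Cut n r)) (G : SimpleGraph (Fin n)) : SimpleGraph (Fin n) :=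
  intGraph fun S : components 𝓒 G => (S : Set (Fin n))

lemma eqvGraph_adj {u v : Fin n} :
    (eqvGraph 𝓒 G).Adj u v ↔ u ≠ v ∧ ∀ P ∈ maxCuts 𝓒 G, P u = P v := by
  constructor
  · rintro ⟨h, ⟨S, hS⟩, hu, hv⟩
    exact ⟨h, Setoid.rel_iff_exists_classes _ |>.2 ⟨S, hS, hu, hv⟩⟩
  · rintro ⟨h, huv⟩
    obtain ⟨S, hS, hu, hv⟩ := (Setoid.rel_iff_exists_classes (cutSetoid 𝓒 G)).1 huv
    exact ⟨h, ⟨S, hS⟩, hu, hv⟩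

lemma exists_maxCuts_of_notMem_eqvGraph {e : Sym2 (Fin n)} (he : ¬ e.IsDiag)
    (h : e ∉ (eqvGraph 𝓒 G).edgeSet) : ∃ P ∈ maxCuts 𝓒 G, e ∈ P.ext.edgeSet := by
  induction e with
  | _ u v =>
    rw [SimpleGraph.mem_edgeSet, eqvGraph_adj] at h
    rw [Sym2.mk_isDiag_iff] at he
    push Not at h
    obtain ⟨P, hP, hne⟩ := h he
    exact ⟨P, hP, Cut.ext_adj.2 hne⟩

/-- Two members of the core are too large to be contained in one part of a balanced cut, so they are
separated by all maximum cuts. -/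
lemma coreExt_le_ext {α δ : ℝ} (hr : 0 < r) (hn : 0 < n) (hα : α ≤ 1 / (16 * r)) (hδ : δ ≤ 1 / 2)
    (hbal : ∀ P ∈ 𝓒, P.IsBalanced δ) (hP : P ∈ maxCuts 𝓒 G) : coreExt α 𝓒 G ≤ P.ext := by
  rintro u v ⟨huv, ⟨S, hS⟩, ⟨T, hT⟩, hST, hu, hv⟩
  rw [Cut.ext_adj]
  intro hPuv
  have hr' : (0 : ℝ) < r := by exact_mod_cast hr
  have hn' : (0 : ℝ) < n := by exact_mod_cast hn
  have hsub : ∀ U ∈ components 𝓒 G, ∀ a ∈ U, U ⊆ P.part (P a) := by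
    intro U hU a ha b hb
    exact (Setoid.rel_iff_exists_classes (cutSetoid 𝓒 G)).2 ⟨U, hU, hb, ha⟩ P hP
  have hSP := hsub S hS.1 u hu
  have hTP := hsub T hT.1 v hv
  rw [← hPuv] at hTP
  have hdisj : Disjoint S T := by
    rw [Set.disjoint_left]
    intro a ha hb
    exact hST (Subtype.ext (Setoid.eq_of_mem_classes hS.1 ha hT.1 hb))
  have hcard : S.ncard + T.ncard ≤ (P.part (P u)).ncard := by
    rw [← Set.ncard_union_eq hdisj]
    exact Set.ncard_le_ncard (Set.union_subset hSP hTP) (Set.toFinite _)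
  have hcard' : (S.ncard : ℝ) + T.ncard ≤ (P.part (P u)).ncard := by exact_mod_cast hcard
  have h1 := hS.2
  have h2 := hT.2
  have h3 := (hbal P hP.1 (P u)).2
  have hq : 0 < (n : ℝ) / r := by positivity
  -- `2 (1 - 4rα) ≥ 3/2 ≥ 1 + δ`
  have h4 : r * α ≤ 1 / 16 := by
    calc r * α ≤ r * (1 / (16 * r)) := mul_le_mul_of_nonneg_left hα hr'.le
      _ = 1 / 16 := by field_simp
  have h5 : (1 + δ) * ((n : ℝ) / r) ≤ 3 / 2 * (n / r) :=
    mul_le_mul_of_nonneg_right (by linarith) hq.le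
  have h6 : 3 / 4 * ((n : ℝ) / r) ≤ (1 - 4 * r * α) * (n / r) :=
    mul_le_mul_of_nonneg_right (by linarith) hq.le
  linarith

end Deletion

/-! ### Matching numbers and links -/

section Links

variable {n : ℕ}

lemma le_matchingNumber {𝓕 M : Set (SimpleGraph (Fin n))} (hM : M ⊆ 𝓕)
    (hd : M.PairwiseDisjoint id) : M.ncard ≤ matchingNumber 𝓕 := by
  refine le_csSup ⟨𝓕.ncard, ?_⟩ ⟨M, hM, hd, rfl⟩
  rintro _ ⟨M', hM', _, rfl⟩
  exact Set.ncard_le_ncard hM' (Set.toFinite _)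

lemma exists_matching (𝓕 : Set (SimpleGraph (Fin n))) :
    ∃ M ⊆ 𝓕, M.PairwiseDisjoint id ∧ M.ncard = matchingNumber 𝓕 := by
  refine Nat.sSup_mem (s := {k | ∃ M ⊆ 𝓕, M.PairwiseDisjoint id ∧ M.ncard = k})
    ⟨0, ∅, by simp⟩ ⟨𝓕.ncard, ?_⟩
  rintro _ ⟨M', hM', _, rfl⟩
  exact Set.ncard_le_ncard hM' (Set.toFinite _)

lemma matchingNumber_mono {𝓕 𝓕' : Set (SimpleGraph (Fin n))} (h : 𝓕 ⊆ 𝓕') :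
    matchingNumber 𝓕 ≤ matchingNumber 𝓕' := by
  obtain ⟨M, hM, hd, hc⟩ := exists_matching 𝓕
  exact hc ▸ le_matchingNumber (hM.trans h) hd

lemma induced_mono (𝓕 : Set (SimpleGraph (Fin n))) {G G' : SimpleGraph (Fin n)} (h : G ≤ G') :
    induced 𝓕 G ⊆ induced 𝓕 G' := fun _ hω => ⟨hω.1, hω.2.trans h⟩

lemma linkCount_mono (𝓕 : Set (SimpleGraph (Fin n))) {G G' : SimpleGraph (Fin n)} (h : G ≤ G') :
    linkCount 𝓕 G ≤ linkCount 𝓕 G' :=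
  Finset.sum_le_sum fun _ _ => Set.ncard_le_ncard (induced_mono _ h) (Set.toFinite _)

/-- The edges whose addition to `G` completes (or keeps) a member of `𝓕`. -/
def linkedEdges (𝓕 : Set (SimpleGraph (Fin n))) (G : SimpleGraph (Fin n)) : Set (Sym2 (Fin n)) :=
  {e | (induced (link e 𝓕) G).Nonempty}

lemma ncard_linkedEdges_le (𝓕 : Set (SimpleGraph (Fin n))) (G : SimpleGraph (Fin n)) :
    (linkedEdges 𝓕 G).ncard ≤ min (n.choose 2) (linkCount 𝓕 G) := by
  classical
  refine le_min ?_ ?_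
  · refine le_trans (Set.ncard_le_ncard (t := (⊤ : SimpleGraph (Fin n)).edgeSet) ?_
      (Set.toFinite _)) (ncard_edgeSet_le _)
    rintro e ⟨_, ⟨ω, _, he, _⟩, _⟩
    exact SimpleGraph.edgeSet_mono le_top he
  · rw [Set.ncard_eq_toFinset_card', Finset.card_eq_sum_ones, linkCount]
    refine le_trans (Finset.sum_le_sum fun e he => ?_)
      (Finset.sum_le_sum_of_subset (Finset.subset_univ _))
    rw [Set.mem_toFinset] at he
    exact (Set.ncard_pos (Set.toFinite _)).2 he

/-- If a family has a large matching inside `G ⊓ I`, but only a small one inside `G ⊓ J`, then there are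
many edges of `G ⊓ I` outside `J` that complete a member of the family. -/
lemma le_ncard_of_matchingNumber_lt {𝓕 : Set (SimpleGraph (Fin n))} {G I J : SimpleGraph (Fin n)}
    {x y : ℕ} (hJ : matchingNumber (induced 𝓕 (G ⊓ J)) ≤ x)
    (hI : x + y ≤ matchingNumber (induced 𝓕 (G ⊓ I))) :
    y ≤ {e ∈ (G ⊓ I).edgeSet \ J.edgeSet | e ∈ linkedEdges 𝓕 (G.deleteEdges {e})}.ncard := by
  obtain ⟨M, hM, hd, hc⟩ := exists_matching (induced 𝓕 (G ⊓ I))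
  have h1 : {ω ∈ M | ω ≤ J}.ncard ≤ x := by
    refine le_trans (le_matchingNumber ?_ (hd.subset (Set.sep_subset _ _))) hJ
    rintro ω ⟨hω, hωJ⟩
    exact ⟨(hM hω).1, le_inf ((hM hω).2.trans inf_le_left) hωJ⟩
  have h2 : M.ncard ≤ {ω ∈ M | ω ≤ J}.ncard + {ω ∈ M | ¬ ω ≤ J}.ncard := by
    refine le_trans (Set.ncard_le_ncard ?_ (Set.toFinite _)) (Set.ncard_union_le _ _)
    intro ω hω
    by_cases h : ω ≤ J
    · exact Or.inl ⟨hω, h⟩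
    · exact Or.inr ⟨hω, h⟩
  have hex : ∀ ω : SimpleGraph (Fin n), ¬ ω ≤ J → ∃ e ∈ ω.edgeSet, e ∉ J.edgeSet := by
    intro ω h
    rw [← SimpleGraph.edgeSet_subset_edgeSet] at h
    exact Set.not_subset.1 h
  have h3 : {ω ∈ M | ¬ ω ≤ J}.ncard ≤
      {e ∈ (G ⊓ I).edgeSet \ J.edgeSet | e ∈ linkedEdges 𝓕 (G.deleteEdges {e})}.ncard := by
    rcases {ω ∈ M | ¬ ω ≤ J}.eq_empty_or_nonempty with h0 | ⟨ω₀, h0⟩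
    · simp [h0]
    -- Distinct members of the matching are edge-disjoint, so they yield distinct edges outside `J`.
    have : Nonempty (Sym2 (Fin n)) := ⟨(hex ω₀ h0.2).choose⟩
    choose! f hf hfJ using hex
    refine Set.ncard_le_ncard_of_injOn f ?_ ?_ (Set.toFinite _)
    · rintro ω ⟨hω, hωJ⟩
      refine ⟨⟨SimpleGraph.edgeSet_mono (hM hω).2 (hf ω hωJ), hfJ ω hωJ⟩,
        ω.deleteEdges {f ω}, ⟨ω, (hM hω).1, hf ω hωJ, rfl⟩, ?_⟩
      exact SimpleGraph.deleteEdges_mono ((hM hω).2.trans inf_le_left)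
    · rintro ω ⟨hω, hωJ⟩ ω' ⟨hω', hωJ'⟩ h
      by_contra hne
      have := SimpleGraph.disjoint_edgeSet.2 (hd hω hω' hne)
      exact Set.disjoint_left.1 this (hf ω hωJ) (h ▸ hf ω' hωJ')
  omega

end Links

/-! ### Edge distribution -/

section Distribution

variable {n r : ℕ}

/-- A balanced cut minimises the number of internal pairs. -/
lemma le_edgeCount_int (hr : 0 < r) (P : Cut n r) :
    (n : ℝ) ^ 2 / (2 * r) - n / 2 ≤ edgeCount P.int := by
  classical
  have hdeg : ∀ v, P.int.degree v + 1 = (Finset.univ.filter fun u => P u = P v).card := by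
    intro v
    have h : Finset.univ.filter (fun u => P u = P v) = insert v (P.int.neighborFinset v) := by
      ext u
      simp only [Finset.mem_filter, Finset.mem_univ, true_and, Finset.mem_insert,
        SimpleGraph.mem_neighborFinset, Cut.int_adj]
      constructor
      · intro h
        by_cases huv : u = v
        · exact Or.inl huv
        · exact Or.inr ⟨Ne.symm huv, h.symm⟩
      · rintro (rfl | ⟨_, h⟩)
        · rfl
        · exact h.symm
    rw [h, Finset.card_insert_of_notMem (by simp), SimpleGraph.card_neighborFinset_eq_degree]
  -- The ordered pairs inside the parts are counted by the sum of the squared part sizes.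
  have hsum := P.int.sum_degrees_eq_twice_card_edges
  have hec : edgeCount P.int = P.int.edgeFinset.card := by
    rw [edgeCount, ← SimpleGraph.coe_edgeFinset, Set.ncard_coe_finset]
  have h1 : 2 * edgeCount P.int + n = ∑ v, (Finset.univ.filter fun u => P u = P v).card := by
    rw [hec, ← hsum, ← Finset.sum_congr rfl fun v _ => hdeg v, Finset.sum_add_distrib]
    simp
  have h2 : ∑ v, (Finset.univ.filter fun u => P u = P v).card =
      ∑ i, (Finset.univ.filter fun u => P u = i).card ^ 2 := by
    rw [← Finset.sum_fiberwise Finset.univ P]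
    refine Finset.sum_congr rfl fun i _ => ?_
    rw [sq, ← smul_eq_mul, ← Finset.sum_const]
    refine Finset.sum_congr rfl fun v hv => ?_
    rw [(Finset.mem_filter.1 hv).2]
  have h3 : ∑ i, (Finset.univ.filter fun u => P u = i).card = n := by
    have := Finset.card_eq_sum_card_fiberwise (f := P) (s := Finset.univ) (t := Finset.univ)
      (by simp)
    simpa using this.symm
  have h4 := sq_sum_le_card_mul_sum_sq (s := (Finset.univ : Finset (Fin r)))
    (f := fun i => (Finset.univ.filter fun u => P u = i).card)
  rw [h3, ← h2, ← h1, Finset.card_univ, Fintype.card_fin] at h4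
  have h5 : (n : ℝ) ^ 2 ≤ r * (2 * edgeCount P.int + n) := by exact_mod_cast h4
  have hr' : (0 : ℝ) < r := by exact_mod_cast hr
  have h6 : (n : ℝ) ^ 2 / (2 * r) ≤ edgeCount P.int + n / 2 := by
    rw [div_le_iff₀ (by positivity)]
    linarith
  linarith

/-- `G` arises by deleting at most `s` edges from a graph whose edges are distributed inside families
of disjoint vertex sets as in a random graph of density `p`, up to an error of `E` edges. -/
def IsNearlyUniform (E p : ℝ) (s : ℕ) (G : SimpleGraph (Fin n)) : Prop :=
  ∃ G₀, G ≤ G₀ ∧ edgeCount G₀ ≤ edgeCount G + s ∧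
    ∀ (k : ℕ) (V : Fin k → Set (Fin n)), Pairwise (fun i j => Disjoint (V i) (V j)) →
      edgeCount (intGraph V) * p - E ≤ edgeCount (G₀ ⊓ intGraph V)

lemma IsNearlyUniform.deleteEdges {E p : ℝ} {s : ℕ} {G : SimpleGraph (Fin n)}
    (h : IsNearlyUniform E p s G) {e : Sym2 (Fin n)} (he : e ∈ G.edgeSet) :
    IsNearlyUniform E p (s + 1) (G.deleteEdges {e}) := by
  obtain ⟨G₀, h1, h2, h3⟩ := h
  refine ⟨G₀, (G.deleteEdges_le _).trans h1, ?_, h3⟩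
  have : edgeCount (G.deleteEdges {e}) + 1 = edgeCount G := ncard_deleteEdges he
  omega

lemma IsNearlyUniform.le_edgeCount {E p : ℝ} {s : ℕ} {G : SimpleGraph (Fin n)}
    (h : IsNearlyUniform E p s G) {k : ℕ} {V : Fin k → Set (Fin n)}
    (hV : Pairwise fun i j => Disjoint (V i) (V j)) :
    edgeCount (intGraph V) * p - E - s ≤ edgeCount (G ⊓ intGraph V) := by
  obtain ⟨G₀, h1, h2, h3⟩ := h
  have h4 : edgeCount (G₀ ⊓ intGraph V) ≤
      edgeCount (G ⊓ intGraph V) + (G₀.edgeSet \ G.edgeSet).ncard := by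
    refine le_trans (Set.ncard_le_ncard ?_ (Set.toFinite _)) (Set.ncard_union_le _ _)
    intro e he
    rw [SimpleGraph.edgeSet_inf] at he
    by_cases hG : e ∈ G.edgeSet
    · exact Or.inl (by rw [SimpleGraph.edgeSet_inf]; exact ⟨hG, he.2⟩)
    · exact Or.inr ⟨he.1, hG⟩
  have h5 := Set.ncard_sdiff_add_ncard_of_subset (SimpleGraph.edgeSet_mono h1) (Set.toFinite _)
  have h6 : edgeCount (G₀ ⊓ intGraph V) ≤ edgeCount (G ⊓ intGraph V) + s := by
    unfold edgeCount at *; omega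
  have h7 : (edgeCount (G₀ ⊓ intGraph V) : ℝ) ≤ edgeCount (G ⊓ intGraph V) + s := by
    exact_mod_cast h6
  linarith [h3 k V hV]

lemma intGraph_comp {ι κ : Type*} (S : ι → Set (Fin n)) (f : κ ≃ ι) :
    intGraph (S ∘ f) = intGraph S := by
  ext u v
  constructor
  · rintro ⟨h, i, hi⟩
    exact ⟨h, f i, hi⟩
  · rintro ⟨h, i, hi⟩
    exact ⟨h, f.symm i, by simpa using hi⟩

lemma IsNearlyUniform.le_edgeCount_eqvGraph {E p : ℝ} {s : ℕ} {G G' : SimpleGraph (Fin n)}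
    (h : IsNearlyUniform E p s G) (𝓒 : Set (Cut n r)) :
    edgeCount (eqvGraph 𝓒 G') * p - E - s ≤ edgeCount (G ⊓ eqvGraph 𝓒 G') := by
  have f := (Finite.equivFin (components 𝓒 G')).symm
  rw [eqvGraph, ← intGraph_comp _ f]
  refine h.le_edgeCount fun i j hij => Set.disjoint_left.2 fun a ha hb => ?_
  exact hij (f.injective (Subtype.ext (Setoid.eq_of_mem_classes (f i).2 ha (f j).2 hb)))

lemma IsNearlyUniform.le_edgeCount_int {E p : ℝ} {s : ℕ} {G : SimpleGraph (Fin n)}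
    (h : IsNearlyUniform E p s G) (P : Cut n r) :
    edgeCount P.int * p - E - s ≤ edgeCount (G ⊓ P.int) := by
  refine h.le_edgeCount fun i j hij => Set.disjoint_left.2 fun a ha hb => ?_
  exact hij (Eq.trans (Eq.symm ha) hb)

lemma edgeCount_le_sq (G : SimpleGraph (Fin n)) : (edgeCount G : ℝ) ≤ (n : ℝ) ^ 2 / 2 := by
  have h1 : (edgeCount G : ℝ) ≤ (n.choose 2 : ℕ) := by exact_mod_cast ncard_edgeSet_le G
  rw [Nat.cast_choose_two] at h1
  have : (0 : ℝ) ≤ n := n.cast_nonneg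
  linarith [h1, sq (n : ℝ)]

end Distribution

/-! ### Deletion chains -/

section Stages

variable {n r : ℕ}

/-- The graphs that occur in a deletion chain after the deletion of at most `s` edges, when the chosen
cut has deficit at most `k`. The number `B` bounds the number of links. -/
def stage (Q : ColouredGraph n r) (δ : ℝ) (𝓕 : Set (SimpleGraph (Fin n))) (x : ℕ) (B E p : ℝ)
    (k s : ℕ) : Set (SimpleGraph (Fin n)) :=
  {G | ((min (n.choose 2) (linkCount 𝓕 G) : ℕ) : ℝ) ≤ B ∧ IsNearlyUniform E p s G ∧
    G ∈ Q.bad δ 𝓕 k x}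

variable {Q : ColouredGraph n r} {δ : ℝ} {𝓕 : Set (SimpleGraph (Fin n))} {x : ℕ} {B E p : ℝ}
  {k k' s : ℕ}

/-- Deleting an edge inside the parts of the chosen cut leads to the next stage. -/
lemma deleteEdges_mem_stage {G : SimpleGraph (Fin n)} {P : Cut n r} {e : Sym2 (Fin n)}
    (hB : ((min (n.choose 2) (linkCount 𝓕 G) : ℕ) : ℝ) ≤ B) (hE : IsNearlyUniform E p s G)
    (hQ : Q.graph ≤ G) (hP : P ∈ Q.cuts δ) (hx : matchingNumber (induced 𝓕 (G ⊓ P.ext)) ≤ x)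
    (he : e ∈ G.edgeSet) (heQ : e ∉ Q.graph.edgeSet) (heP : e ∉ P.ext.edgeSet)
    (hk : maxCutSize (Q.cuts δ) (G.deleteEdges {e}) ≤ edgeCount (G ⊓ P.ext) + k) :
    G.deleteEdges {e} ∈ stage Q δ 𝓕 x B E p k (s + 1) := by
  have hle : G.deleteEdges {e} ≤ G := G.deleteEdges_le _
  refine ⟨le_trans ?_ hB, hE.deleteEdges he, ?_, P, hP, ?_, ?_⟩
  · exact_mod_cast min_le_min le_rfl (linkCount_mono 𝓕 hle)
  · rw [← SimpleGraph.edgeSet_subset_edgeSet, SimpleGraph.edgeSet_deleteEdges]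
    exact Set.subset_sdiff_singleton (SimpleGraph.edgeSet_mono hQ) heQ
  · rw [deficit, edgeCount_deleteEdges_inf_of_notMem heP]
    omega
  · exact (matchingNumber_mono (induced_mono _ (inf_le_inf_right _ hle))).trans hx

/-- The graphs `G ⊇ Q` that are rigid and have a small matching number across their core. -/
def goodGraphs (Q : ColouredGraph n r) (α δ : ℝ) (𝓕 : Set (SimpleGraph (Fin n))) (y : ℕ) :
    Set (SimpleGraph (Fin n)) :=
  {G | Q.graph ≤ G ∧ IsRigid α (Q.cuts δ) G ∧
    matchingNumber (induced 𝓕 (G ⊓ coreExt α (Q.cuts δ) G)) ≤ y}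

/-- The rigid graphs for the pair `(𝓒_Q, α)`. -/
def rigidGraphs (Q : ColouredGraph n r) (α δ : ℝ) : Set (SimpleGraph (Fin n)) :=
  {G | IsRigid α (Q.cuts δ) G}

variable {α : ℝ} {y m : ℕ}

/-- A rigid graph that is not good has many edges that cross its core, lie inside the parts of the
chosen cut, and complete a member of `𝓕`. Deleting such an edge decreases the deficit. -/
lemma rigid_step (hr : 0 < r) (hn : 0 < n) (hα : α ≤ 1 / (16 * r)) (hδ : δ ≤ 1 / 2)
    (h𝓕 : ∀ ω ∈ 𝓕, Disjoint ω Q.graph) (hy : x + m ≤ y) {G : SimpleGraph (Fin n)}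
    (hG : G ∈ stage Q δ 𝓕 x B E p k s) (hrig : G ∈ rigidGraphs Q α δ)
    (hgood : G ∉ goodGraphs Q α δ 𝓕 y) :
    ∃ c : Set (Sym2 (Fin n)), c ⊆ G.edgeSet ∧ m + 1 ≤ c.ncard ∧ ∀ e ∈ c, ∃ k', k = k' + 1 ∧
      G.deleteEdges {e} ∈ stage Q δ 𝓕 x B E p k' (s + 1) ∧
      e ∈ linkedEdges 𝓕 (G.deleteEdges {e}) := by
  obtain ⟨hB, hE, hQ, P, hP, hk, hx⟩ := hG
  have hlt : y < matchingNumber (induced 𝓕 (G ⊓ coreExt α (Q.cuts δ) G)) := by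
    by_contra h
    exact hgood ⟨hQ, hrig, not_lt.1 h⟩
  refine ⟨_, ?_, le_ncard_of_matchingNumber_lt (y := m + 1) hx
    (I := coreExt α (Q.cuts δ) G) (by omega), ?_⟩
  · rintro e ⟨⟨he, _⟩, _⟩
    exact SimpleGraph.edgeSet_mono inf_le_left he
  · rintro e ⟨⟨he, heP⟩, hlink⟩
    rw [SimpleGraph.edgeSet_inf] at he
    have hne : (Q.cuts δ).Nonempty := ⟨P, hP⟩
    have heQ : e ∉ Q.graph.edgeSet := by
      obtain ⟨_, ⟨ω, hω, heω, _⟩, _⟩ := hlink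
      exact Set.disjoint_left.1 (SimpleGraph.disjoint_edgeSet.2 (h𝓕 ω hω)) heω
    have hdrop := maxCutSize_deleteEdges_lt hne he.1 fun P' hP' =>
      SimpleGraph.edgeSet_mono
        (coreExt_le_ext hr hn hα hδ (fun P'' hP'' => hP''.1) hP') he.2
    have hle : edgeCount (G ⊓ P.ext) ≤ maxCutSize (Q.cuts δ) (G.deleteEdges {e}) := by
      rw [← edgeCount_deleteEdges_inf_of_notMem heP]
      exact edgeCount_le_maxCutSize hP
    rw [deficit] at hk
    exact ⟨k - 1, by omega, deleteEdges_mem_stage hB hE hQ hP hx he.1 heQ heP (by omega), hlink⟩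

/-- Deleting an edge inside the parts of the chosen cut either decreases the deficit, or the ends of
the edge are equivalent in the resulting graph. -/
lemma nonrigid_step {G : SimpleGraph (Fin n)} (hG : G ∈ stage Q δ 𝓕 x B E p k s) :
    ∃ P : Cut n r, ∀ e ∈ (G ⊓ P.int).edgeSet \ Q.graph.edgeSet,
      (∃ k', k = k' + 1 ∧ G.deleteEdges {e} ∈ stage Q δ 𝓕 x B E p k' (s + 1)) ∨
      (G.deleteEdges {e} ∈ stage Q δ 𝓕 x B E p k (s + 1) ∧
        e ∈ (eqvGraph (Q.cuts δ) (G.deleteEdges {e})).edgeSet) := by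
  obtain ⟨hB, hE, hQ, P, hP, hk, hx⟩ := hG
  refine ⟨P, ?_⟩
  rintro e ⟨he, heQ⟩
  rw [SimpleGraph.edgeSet_inf] at he
  have hne : (Q.cuts δ).Nonempty := ⟨P, hP⟩
  have heP : e ∉ P.ext.edgeSet := by
    have h := he.2
    induction e with
    | _ u v =>
      rw [SimpleGraph.mem_edgeSet, Cut.int_adj] at h
      rw [SimpleGraph.mem_edgeSet, Cut.ext_adj]
      exact not_not.2 h.2
  have hle : edgeCount (G ⊓ P.ext) ≤ maxCutSize (Q.cuts δ) (G.deleteEdges {e}) := by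
    rw [← edgeCount_deleteEdges_inf_of_notMem heP]
    exact edgeCount_le_maxCutSize hP
  rw [deficit] at hk
  by_cases heq : e ∈ (eqvGraph (Q.cuts δ) (G.deleteEdges {e})).edgeSet
  · have := maxCutSize_mono hne (G.deleteEdges_le {e})
    exact Or.inr ⟨deleteEdges_mem_stage hB hE hQ hP hx he.1 heQ heP (by omega), heq⟩
  · obtain ⟨P', hP', hcross⟩ :=
      exists_maxCuts_of_notMem_eqvGraph (SimpleGraph.not_isDiag_of_mem_edgeSet _ he.1) heq
    have := maxCutSize_deleteEdges_lt_of_maxCuts he.1 hP' hcross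
    exact Or.inl ⟨k - 1, by omega,
      deleteEdges_mem_stage hB hE hQ hP hx he.1 heQ heP (by omega)⟩

end Stages

/-! ### Recursive bounds for the stages -/

section Recursion

variable {n r : ℕ}

/-- The graphs of the stage whose deficit is smaller by one; there are none for `k = 0`. -/
def earlierStage (Q : ColouredGraph n r) (δ : ℝ) (𝓕 : Set (SimpleGraph (Fin n))) (x : ℕ)
    (B E p : ℝ) (k s : ℕ) : Set (SimpleGraph (Fin n)) :=
  {G | ∃ k', k = k' + 1 ∧ G ∈ stage Q δ 𝓕 x B E p k' s}

variable {Q : ColouredGraph n r} {α δ : ℝ} {𝓕 : Set (SimpleGraph (Fin n))} {x y m : ℕ} {B E : ℝ}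
  {p : unitInterval} {k s : ℕ}

/-- A rigid graph is good, or a deletion leads to a stage with smaller deficit. There are more than `m`
choices for the deletion, and at most `D m / p` ways to undo it. -/
lemma rigid_recursion (hr : 0 < r) (hn : 0 < n) (hα : α ≤ 1 / (16 * r)) (hδ : δ ≤ 1 / 2)
    (h𝓕 : ∀ ω ∈ 𝓕, Disjoint ω Q.graph) (hy : x + m ≤ y) (hp : 0 < (p : ℝ)) (hp1 : (p : ℝ) < 1)
    {D : ℕ} :
    (SimpleGraph.binomialRandom (Fin n) p).real
        (stage Q δ 𝓕 x (D * m / p) E p k s ∩ rigidGraphs Q α δ) ≤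
      (SimpleGraph.binomialRandom (Fin n) p).real (goodGraphs Q α δ 𝓕 y) +
        D / (1 - p) * (SimpleGraph.binomialRandom (Fin n) p).real
          (earlierStage Q δ 𝓕 x (D * m / p) E p k (s + 1)) := by
  set μ := SimpleGraph.binomialRandom (Fin n) p
  set 𝒜 := (stage Q δ 𝓕 x (D * m / p) E p k s ∩ rigidGraphs Q α δ) \ goodGraphs Q α δ 𝓕 y
  have h1 : μ.real (stage Q δ 𝓕 x (D * m / p) E p k s ∩ rigidGraphs Q α δ) ≤
      μ.real (goodGraphs Q α δ 𝓕 y) + μ.real 𝒜 := by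
    refine le_trans (measureReal_mono ?_) (measureReal_union_le _ _)
    intro G hG
    by_cases h : G ∈ goodGraphs Q α δ 𝓕 y
    · exact Or.inl h
    · exact Or.inr ⟨hG, h⟩
  have hex : ∀ G ∈ 𝒜, ∃ c : Set (Sym2 (Fin n)), c ⊆ G.edgeSet ∧ m + 1 ≤ c.ncard ∧ ∀ e ∈ c,
      ∃ k', k = k' + 1 ∧ G.deleteEdges {e} ∈ stage Q δ 𝓕 x (D * m / p) E p k' (s + 1) ∧
      e ∈ linkedEdges 𝓕 (G.deleteEdges {e}) := fun G hG =>
    rigid_step hr hn hα hδ h𝓕 hy hG.1.1 hG.1.2 hG.2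
  choose! c hc hcard hcstep using hex
  have h2 := switching p 𝒜 (fun _ : Unit => earlierStage Q δ 𝓕 x (D * m / p) E p k (s + 1)) c
    (fun _ => linkedEdges 𝓕) (m + 1 : ℝ) (fun _ => D * m / p) hc
    (fun G hG => by exact_mod_cast hcard G hG)
    (fun _ G hG => by
      obtain ⟨k', _, hG⟩ := hG
      exact le_trans (by exact_mod_cast ncard_linkedEdges_le 𝓕 G) hG.1)
    (fun G hG e he => by
      obtain ⟨k', hk, hmem, hlink⟩ := hcstep G hG e he
      exact ⟨(), ⟨k', hk, hmem⟩, hlink⟩)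
  simp only [Finset.univ_unique, Finset.sum_singleton] at h2
  set X := μ.real (earlierStage Q δ 𝓕 x (D * m / p) E p k (s + 1))
  have hX : 0 ≤ X := measureReal_nonneg
  have h3 : (1 - (p : ℝ)) * ((m + 1) * μ.real 𝒜) ≤ (m + 1) * (D * X) := by
    refine h2.trans ?_
    have : (p : ℝ) * (D * m / p * X) = m * (D * X) := by field_simp
    rw [this]
    have : 0 ≤ (D : ℝ) * X := by positivity
    nlinarith
  have h4 : (1 - (p : ℝ)) * μ.real 𝒜 ≤ D * X := by
    have hm : (0 : ℝ) < m + 1 := by positivity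
    refine le_of_mul_le_mul_left ?_ hm
    linarith
  have h5 : μ.real 𝒜 ≤ D / (1 - p) * X := by
    rw [div_mul_eq_mul_div, le_div_iff₀ (by linarith)]
    linarith
  linarith

/-- In a graph that is not rigid, few non-edges join equivalent vertices. -/
lemma ncard_eqvGraph_sdiff_le (hp1 : (p : ℝ) < 1) {G : SimpleGraph (Fin n)}
    (hG : IsNearlyUniform E p s G) (hrig : ¬ IsRigid α (Q.cuts δ) G) :
    (((eqvGraph (Q.cuts δ) G).edgeSet \ G.edgeSet).ncard : ℝ) ≤
      (1 - α) * (n : ℝ) ^ 2 / (2 * r) * (1 - p) + E + s := by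
  have h1 := hG.le_edgeCount_eqvGraph (G' := G) (Q.cuts δ)
  have h2 := Set.ncard_inter_add_ncard_sdiff_eq_ncard (eqvGraph (Q.cuts δ) G).edgeSet G.edgeSet
    (Set.toFinite _)
  have h3 : edgeCount (G ⊓ eqvGraph (Q.cuts δ) G) =
      ((eqvGraph (Q.cuts δ) G).edgeSet ∩ G.edgeSet).ncard := by
    rw [edgeCount, SimpleGraph.edgeSet_inf, Set.inter_comm]
  have h4 : (edgeCount (G ⊓ eqvGraph (Q.cuts δ) G) : ℝ) +
      ((eqvGraph (Q.cuts δ) G).edgeSet \ G.edgeSet).ncard = edgeCount (eqvGraph (Q.cuts δ) G) := by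
    rw [h3]; exact_mod_cast h2
  have h5 : (edgeCount (eqvGraph (Q.cuts δ) G) : ℝ) ≤ (1 - α) * (n : ℝ) ^ 2 / (2 * r) :=
    (not_le.1 hrig).le
  have h6 := mul_le_mul_of_nonneg_right h5 (by linarith : 0 ≤ 1 - (p : ℝ))
  linarith

/-- The computation behind `nonrigid_recursion`: `N` stands for `n²`, and `F` for the error terms. -/
lemma nonrigid_inequality {α p p₀ Γ N r F ν X Y W : ℝ} (hr' : 1 ≤ r) (hα0 : 0 < α) (hα1 : α ≤ 1)
    (hp : 0 < p) (hpp : p ≤ p₀) (hp1 : p₀ < 1) (hN : 0 < N) (hF : 0 ≤ F) (hFs : F ≤ Γ * (N * p))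
    (hΓ : Γ = α * (1 - p₀) / (8 * r)) (hν : 0 ≤ ν) (hX : 0 ≤ X) (hY : 0 ≤ Y) (hW : 0 ≤ W)
    (hsw : (1 - p) * ((1 / (2 * r) - Γ) * (N * p) * ν) ≤
      p * (N / 2 * X + N / 2 * Y + ((1 - α) * N / (2 * r) * (1 - p) + F) * W)) :
    ν ≤ 2 * r / (1 - p₀) * X + 2 * r / (1 - p₀) * Y + (1 - α / 2) * W := by
  have hq : 0 < 1 - p := by linarith
  have hq₀ : 0 < 1 - p₀ := by linarith
  have hqq : 1 - p₀ ≤ 1 - p := by linarith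
  set M : ℝ := N * p with hM
  have hM0 : 0 < M := by positivity
  have hΓr : 2 * r * Γ = α * (1 - p₀) / 4 := by rw [hΓ]; field_simp; ring
  have hΓ0 : 0 ≤ Γ := by rw [hΓ]; positivity
  -- The switching inequality, divided by `M / (2r)`.
  have h1 : (1 - p) * ((1 - 2 * r * Γ) * ν) ≤
      r * X + r * Y + ((1 - α) * (1 - p) + 2 * r * Γ) * W := by
    have hpE : p * F * W ≤ Γ * M * W := by
      refine mul_le_mul_of_nonneg_right ?_ hW
      have : p * F ≤ 1 * F :=
        mul_le_mul_of_nonneg_right (by linarith) hF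
      linarith
    have h2 : (1 - p) * ((1 / (2 * r) - Γ) * M * ν) ≤
        M / 2 * X + M / 2 * Y + ((1 - α) * (1 - p) / (2 * r) * M + Γ * M) * W := by
      have e1 : p * (N / 2 * X + N / 2 * Y +
          ((1 - α) * N / (2 * r) * (1 - p) + F) * W) =
          M / 2 * X + M / 2 * Y + ((1 - α) * (1 - p) / (2 * r) * M) * W +
            p * F * W := by rw [hM]; ring
      linarith
    have h3 := mul_le_mul_of_nonneg_left h2 (by positivity : 0 ≤ 2 * r / M)
    have e2 : 2 * r / M * ((1 - p) * ((1 / (2 * r) - Γ) * M * ν)) =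
        (1 - p) * ((1 - 2 * r * Γ) * ν) := by field_simp
    have e3 : 2 * r / M * (M / 2 * X + M / 2 * Y +
        ((1 - α) * (1 - p) / (2 * r) * M + Γ * M) * W) =
        r * X + r * Y + ((1 - α) * (1 - p) + 2 * r * Γ) * W := by field_simp
    linarith
  have hαp : α * (1 - p₀) ≤ α * (1 - p) := mul_le_mul_of_nonneg_left hqq hα0.le
  have hp₀ : 0 < p₀ := hp.trans_le hpp
  have h4 : (1 - p) * ((1 - α / 4) * ν) ≤
      r * X + r * Y + (1 - p) * (1 - 3 * α / 4) * W := by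
    have hA : (1 - α / 4) * ν ≤ (1 - 2 * r * Γ) * ν := by
      refine mul_le_mul_of_nonneg_right ?_ hν
      rw [hΓr]
      linarith [mul_pos hα0 hp₀]
    have hB := mul_le_mul_of_nonneg_left hA hq.le
    have hC : ((1 - α) * (1 - p) + 2 * r * Γ) * W ≤ (1 - p) * (1 - 3 * α / 4) * W := by
      refine mul_le_mul_of_nonneg_right ?_ hW
      rw [hΓr]
      linarith
    linarith
  have h5 : (1 - α / 4) * ν ≤ r / (1 - p₀) * (X + Y) + (1 - 3 * α / 4) * W := by
    have h6 : (1 - p) * ((1 - α / 4) * ν) ≤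
        (1 - p) * (r / (1 - p₀) * (X + Y) + (1 - 3 * α / 4) * W) := by
      have h7 : (1 - p₀) * (r / (1 - p₀) * (X + Y)) ≤ (1 - p) * (r / (1 - p₀) * (X + Y)) :=
        mul_le_mul_of_nonneg_right hqq (by positivity)
      have h8 : (1 - p₀) * (r / (1 - p₀) * (X + Y)) = r * X + r * Y := by field_simp
      linarith
    exact le_of_mul_le_mul_left h6 hq
  have hc : 0 < 1 - α / 4 := by linarith
  refine le_of_mul_le_mul_left (h5.trans ?_) hc
  have h9 : 0 ≤ r / (1 - p₀) * (X + Y) := by positivity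
  have h10 : (1 - 3 * α / 4) * W ≤ (1 - α / 4) * ((1 - α / 2) * W) := by
    rw [← mul_assoc]
    refine mul_le_mul_of_nonneg_right ?_ hW
    linarith [mul_pos hα0 hα0]
  have h11 : r / (1 - p₀) * (X + Y) ≤ (1 - α / 4) * (2 * (r / (1 - p₀) * (X + Y))) := by
    have := mul_le_mul_of_nonneg_right (by linarith : 1 / 2 ≤ 1 - α / 4)
      (by linarith : 0 ≤ 2 * (r / (1 - p₀) * (X + Y)))
    linarith
  have e4 : 2 * r / (1 - p₀) * X + 2 * r / (1 - p₀) * Y = 2 * (r / (1 - p₀) * (X + Y)) := by ring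
  rw [e4, mul_add]
  linarith

/-- If `Γ n² p` bounds all error terms, then the probability of a stage that is not rigid is governed by
its successors. The factor of the successor that is neither rigid nor of smaller deficit is less
than `1`: fewer pairs are equivalent in it than lie inside the parts of a cut. -/
lemma nonrigid_recursion (hr : 0 < r) (hn : 0 < n) (hα0 : 0 < α) (hα1 : α ≤ 1) {p₀ Γ : ℝ}
    (hp : 0 < (p : ℝ)) (hpp : (p : ℝ) ≤ p₀) (hp1 : p₀ < 1) (hE : 0 ≤ E)
    (hΓ : Γ = α * (1 - p₀) / (8 * r))
    (herr : E + (s + 1) + edgeCount Q.graph + n * p / 2 ≤ Γ * ((n : ℝ) ^ 2 * p)) :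
    (SimpleGraph.binomialRandom (Fin n) p).real (stage Q δ 𝓕 x B E p k s \ rigidGraphs Q α δ) ≤
      2 * r / (1 - p₀) * (SimpleGraph.binomialRandom (Fin n) p).real
          (earlierStage Q δ 𝓕 x B E p k (s + 1)) +
        2 * r / (1 - p₀) * (SimpleGraph.binomialRandom (Fin n) p).real
          (stage Q δ 𝓕 x B E p k (s + 1) ∩ rigidGraphs Q α δ) +
        (1 - α / 2) * (SimpleGraph.binomialRandom (Fin n) p).real
          (stage Q δ 𝓕 x B E p k (s + 1) \ rigidGraphs Q α δ) := by
  set μ := SimpleGraph.binomialRandom (Fin n) p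
  have hr' : (1 : ℝ) ≤ r := by exact_mod_cast hr
  have hn' : (0 : ℝ) < n := by exact_mod_cast hn
  set 𝒜 := stage Q δ 𝓕 x B E p k s \ rigidGraphs Q α δ
  set ℬ : Fin 3 → Set (SimpleGraph (Fin n)) := ![earlierStage Q δ 𝓕 x B E p k (s + 1),
    stage Q δ 𝓕 x B E p k (s + 1) ∩ rigidGraphs Q α δ,
    stage Q δ 𝓕 x B E p k (s + 1) \ rigidGraphs Q α δ] with hℬ
  have hex : ∀ G ∈ 𝒜, ∃ P : Cut n r, ∀ e ∈ (G ⊓ P.int).edgeSet \ Q.graph.edgeSet,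
      (∃ k', k = k' + 1 ∧ G.deleteEdges {e} ∈ stage Q δ 𝓕 x B E p k' (s + 1)) ∨
      (G.deleteEdges {e} ∈ stage Q δ 𝓕 x B E p k (s + 1) ∧
        e ∈ (eqvGraph (Q.cuts δ) (G.deleteEdges {e})).edgeSet) := fun G hG => nonrigid_step hG.1
  have : Nonempty (Cut n r) := ⟨fun _ => ⟨0, hr⟩⟩
  choose! P hP using hex
  have hsw := switching p 𝒜 ℬ (fun G => (G ⊓ (P G).int).edgeSet \ Q.graph.edgeSet)
    ![fun G => (⊤ : SimpleGraph (Fin n)).edgeSet, fun G => (⊤ : SimpleGraph (Fin n)).edgeSet,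
      fun G => (eqvGraph (Q.cuts δ) G).edgeSet \ G.edgeSet]
    ((1 / (2 * r) - Γ) * ((n : ℝ) ^ 2 * p))
    ![(n : ℝ) ^ 2 / 2, (n : ℝ) ^ 2 / 2, (1 - α) * (n : ℝ) ^ 2 / (2 * r) * (1 - p) + (E + (s + 1))]
    ?_ ?_ ?_ ?_
  · simp only [Fin.sum_univ_three, hℬ, Matrix.cons_val_zero, Matrix.cons_val_one,
      Matrix.cons_val] at hsw
    have hEs : E + (s + 1) ≤ Γ * ((n : ℝ) ^ 2 * p) := by
      have : (0 : ℝ) ≤ edgeCount Q.graph + n * p / 2 := by positivity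
      linarith
    exact nonrigid_inequality hr' hα0 hα1 hp hpp hp1 (by positivity) (by positivity) hEs hΓ
      measureReal_nonneg measureReal_nonneg measureReal_nonneg measureReal_nonneg
      hsw
  · rintro G - e ⟨he, _⟩
    exact SimpleGraph.edgeSet_mono inf_le_left he
  · rintro G ⟨⟨_, hG, _⟩, _⟩
    have h1 := hG.le_edgeCount_int (P G)
    have h2 := le_edgeCount_int hr (P G)
    have h3 : (edgeCount (G ⊓ (P G).int) : ℝ) ≤
        ((G ⊓ (P G).int).edgeSet \ Q.graph.edgeSet).ncard + edgeCount Q.graph := by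
      exact_mod_cast Set.ncard_le_ncard_sdiff_add_ncard _ _ (Set.toFinite _)
    have h4 := mul_le_mul_of_nonneg_right h2 hp.le
    have h5 : ((n : ℝ) ^ 2 / (2 * r) - n / 2) * p =
        1 / (2 * r) * ((n : ℝ) ^ 2 * p) - n * p / 2 := by ring
    linarith
  · intro i G hG
    fin_cases i
    · exact edgeCount_le_sq _
    · exact edgeCount_le_sq _
    · have := ncard_eqvGraph_sdiff_le (hpp.trans_lt hp1) hG.1.2.1 hG.2
      push_cast at this
      simpa [add_assoc] using this
  · intro G hG e he
    have hdiag : e ∈ (⊤ : SimpleGraph (Fin n)).edgeSet := SimpleGraph.edgeSet_mono le_top he.1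
    rcases hP G hG e he with h | ⟨h1, h2⟩
    · exact ⟨0, h, hdiag⟩
    · by_cases hrig : G.deleteEdges {e} ∈ rigidGraphs Q α δ
      · exact ⟨1, ⟨h1, hrig⟩, hdiag⟩
      · exact ⟨2, ⟨h1, hrig⟩, h2, by simp [SimpleGraph.edgeSet_deleteEdges]⟩

end Recursion

/-- The solution of the recursion: `q` and `ν` stand for the probabilities of the rigid and of the other
graphs of a stage, `j` for the number of deletions that remain. -/
lemma recursion_bound {q ν : ℕ → ℕ → ℝ} {N : ℕ} {g π A D β : ℝ} (hg : 0 ≤ g) (hπ : 0 ≤ π)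
    (hA : 0 ≤ A) (hD : 1 ≤ D) (hβ : 0 < β) (hβ1 : β ≤ 1)
    (hqπ : ∀ k j, q k j ≤ π) (hνπ : ∀ k j, ν k j ≤ π)
    (hq0 : ∀ j < N, q 0 (j + 1) ≤ g)
    (hqs : ∀ k, ∀ j < N, q (k + 1) (j + 1) ≤ g + A * D * (q k j + ν k j))
    (hν0 : ∀ j < N, ν 0 (j + 1) ≤ A * q 0 j + (1 - β) * ν 0 j)
    (hνs : ∀ k, ∀ j < N, ν (k + 1) (j + 1) ≤
      A * (q k j + ν k j) + A * q (k + 1) j + (1 - β) * ν (k + 1) j)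
    {U T : ℝ} (hU : U = 2 * (2 * A + 1) / β) (hT : T = 1 + 2 * A * (1 + U)) (k : ℕ) :
    ∀ j ≤ N, q k j + ν k j ≤ (1 + U) * ((T * D) ^ k * (g + π * (1 - β / 2) ^ j)) := by
  set θ : ℝ := 1 - β / 2 with hθ
  have hθ2 : 1 / 2 ≤ θ := by linarith
  have hθ1 : θ ≤ 1 := by linarith
  have hUβ : U * β = 2 * (2 * A + 1) := by rw [hU]; field_simp
  have hU1 : 1 ≤ U := by
    rw [hU, le_div_iff₀ hβ]; linarith
  have hAU : 0 ≤ A * (1 + U) := by positivity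
  have hT1 : 1 ≤ T := by rw [hT]; nlinarith
  have hTD : 1 ≤ T * D := one_le_mul_of_one_le_of_one_le hT1 hD
  -- `S j` is the value of the bound when `j` deletions remain, up to powers of `T D`.
  set S : ℕ → ℝ := fun j => g + π * θ ^ j with hS
  have hS0 : ∀ j, 0 ≤ S j := fun j => by have : 0 ≤ θ := by linarith
                                         positivity
  have hSs : ∀ j, S j ≤ 2 * S (j + 1) := by
    intro j
    have h1 : 0 ≤ π * θ ^ j := by have : 0 ≤ θ := by linarith
                                  positivity
    have h2 : π * θ ^ (j + 1) = θ * (π * θ ^ j) := by ring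
    have h3 : 1 / 2 * (π * θ ^ j) ≤ θ * (π * θ ^ j) := mul_le_mul_of_nonneg_right hθ2 h1
    simp only [hS]
    linarith
  have hSθ : ∀ j, (1 - β) * S j ≤ (1 - β / 2) * S (j + 1) := by
    intro j
    have h1 : 0 ≤ π * θ ^ j := by have : 0 ≤ θ := by linarith
                                  positivity
    have h2 : (1 - β) * (π * θ ^ j) ≤ (1 - β / 2) * (π * θ ^ (j + 1)) := by
      rw [show (1 - β / 2) * (π * θ ^ (j + 1)) = (θ * θ) * (π * θ ^ j) by rw [hθ]; ring]
      refine mul_le_mul_of_nonneg_right ?_ h1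
      nlinarith
    have h3 : (1 - β) * g ≤ (1 - β / 2) * g := mul_le_mul_of_nonneg_right (by linarith) hg
    simp only [hS]
    linarith
  have main : ∀ j ≤ N, ∀ k, q k j ≤ (T * D) ^ k * S j ∧ ν k j ≤ U * ((T * D) ^ k * S j) := by
    intro j
    induction j with
    | zero =>
      intro _ k
      have h1 : 1 ≤ (T * D) ^ k := one_le_pow₀ hTD
      have h2 : π ≤ (T * D) ^ k * S 0 := by
        have : π ≤ S 0 := by simp [hS, hg]
        have := hS0 0
        nlinarith
      exact ⟨(hqπ k 0).trans h2, (hνπ k 0).trans (h2.trans (by nlinarith))⟩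
    | succ j ih =>
      intro hj k
      have hjN : j < N := hj
      have ihj := ih hjN.le
      have hAS : A * S j ≤ 2 * (A * S (j + 1)) := by nlinarith [hSs j]
      have hUS : U * ((1 - β) * S j) ≤ U * ((1 - β / 2) * S (j + 1)) :=
        mul_le_mul_of_nonneg_left (hSθ j) (by linarith)
      have hsplit : U * ((1 - β / 2) * S (j + 1)) = U * S (j + 1) - (2 * A + 1) * S (j + 1) := by
        linear_combination -(1 / 2) * S (j + 1) * hUβ
      -- The contraction factor `1 - β` leaves room for the term `A * q k j`, as `U β` is large.
      have hνstep : ∀ k, A * q k j + (1 - β) * ν k j ≤ (T * D) ^ k * (U * S (j + 1) - S (j + 1)) := by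
        intro k
        have hpow : 0 ≤ (T * D) ^ k := by positivity
        have h1 := mul_le_mul_of_nonneg_left (ihj k).1 hA
        have h2 := mul_le_mul_of_nonneg_left (ihj k).2 (by linarith : 0 ≤ 1 - β)
        have h3 : A * S j + U * ((1 - β) * S j) ≤ U * S (j + 1) - S (j + 1) := by linarith
        have h4 := mul_le_mul_of_nonneg_left h3 hpow
        linarith
      rcases k with _ | k
      · constructor
        · have h1 : g ≤ S (j + 1) := by
            have : 0 ≤ π * θ ^ (j + 1) := by have : 0 ≤ θ := by linarith
                                             positivity
            simp only [hS]; linarith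
          simpa using (hq0 j hjN).trans h1
        · have := hνstep 0
          have h2 := hS0 (j + 1)
          simp only [pow_zero, one_mul] at this ⊢
          linarith [hν0 j hjN]
      · have hpow : 0 ≤ (T * D) ^ k := by positivity
        have hpow1 : 1 ≤ (T * D) ^ k := one_le_pow₀ hTD
        have hsum : A * (q k j + ν k j) ≤ (T * D) ^ k * (2 * (A * (1 + U)) * S (j + 1)) := by
          have h1 := mul_le_mul_of_nonneg_left (add_le_add (ihj k).1 (ihj k).2) hA
          have h2 := mul_le_mul_of_nonneg_left (hSs j) (mul_nonneg hpow hAU)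
          linarith
        constructor
        · have h1 : g ≤ (T * D) ^ k * S (j + 1) := by
            have h0 : 0 ≤ π * θ ^ (j + 1) := by have : 0 ≤ θ := by linarith
                                                positivity
            have h2 : g ≤ S (j + 1) := by simp only [hS]; linarith
            have := hS0 (j + 1)
            nlinarith
          have h2 : (T * D) ^ (k + 1) * S (j + 1) =
              D * ((T * D) ^ k * S (j + 1)) +
                D * ((T * D) ^ k * (2 * (A * (1 + U)) * S (j + 1))) := by
            rw [pow_succ]
            nth_rewrite 2 [hT]
            ring
          have h3 := hqs k j hjN
          have h4 := mul_le_mul_of_nonneg_left hsum (by linarith : 0 ≤ D)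
          have h5 : (T * D) ^ k * S (j + 1) ≤ D * ((T * D) ^ k * S (j + 1)) :=
            le_mul_of_one_le_left (mul_nonneg hpow (hS0 _)) hD
          linarith
        · have h1 := hνs k j hjN
          have h2 := hνstep (k + 1)
          have h3 : (T * D) ^ k * (2 * (A * (1 + U)) * S (j + 1)) ≤ (T * D) ^ (k + 1) * S (j + 1) := by
            rw [pow_succ, mul_assoc ((T * D) ^ k)]
            refine mul_le_mul_of_nonneg_left (mul_le_mul_of_nonneg_right ?_ (hS0 _)) hpow
            have : T * 1 ≤ T * D := mul_le_mul_of_nonneg_left hD (by linarith)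
            linarith
          linarith
  intro j hj
  have := main j hj k
  simp only [hS] at this
  linarith [this.1, this.2]

/-! ### The bound for a full chain and the number of deletions -/

section Assembly

variable {n r : ℕ}

/-- The factor `A` of those steps of a deletion chain that lead to a rigid graph or to a smaller deficit. -/
def constA (r : ℕ) (p₀ : ℝ) : ℝ := 2 * r / (1 - p₀)

/-- The ratio between the bounds for the graphs of a stage that are not rigid and those that are. -/
def constU (r : ℕ) (p₀ α : ℝ) : ℝ := 2 * (2 * constA r p₀ + 1) / (α / 2)

/-- The factor, up to `D`, by which the bound for a stage grows with its deficit. -/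
def constT (r : ℕ) (p₀ α : ℝ) : ℝ := 1 + 2 * constA r p₀ * (1 + constU r p₀ α)

lemma earlierStage_zero {Q : ColouredGraph n r} {δ : ℝ} {𝓕 : Set (SimpleGraph (Fin n))} {x s : ℕ}
    {B E p : ℝ} : earlierStage Q δ 𝓕 x B E p 0 s = ∅ := by
  ext G
  simp [earlierStage]

lemma earlierStage_succ {Q : ColouredGraph n r} {δ : ℝ} {𝓕 : Set (SimpleGraph (Fin n))} {x k s : ℕ}
    {B E p : ℝ} : earlierStage Q δ 𝓕 x B E p (k + 1) s = stage Q δ 𝓕 x B E p k s := by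
  ext G
  simp [earlierStage]

/-- The bound for all chains of `N` deletions that begin with a cut of deficit at most `d`. -/
lemma stage_bound {Q : ColouredGraph n r} {α δ : ℝ} {𝓕 : Set (SimpleGraph (Fin n))}
    {x y m D N : ℕ} {E p₀ : ℝ} {p : unitInterval} (hr : 0 < r) (hn : 0 < n) (hα0 : 0 < α)
    (hα : α ≤ 1 / (16 * r)) (hδ : δ ≤ 1 / 2) (h𝓕 : ∀ ω ∈ 𝓕, Disjoint ω Q.graph) (hy : x + m ≤ y)
    (hp : 0 < (p : ℝ)) (hpp : (p : ℝ) ≤ p₀) (hp1 : p₀ < 1) (hE : 0 ≤ E) (hD : 1 ≤ D)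
    (herr : E + N + edgeCount Q.graph + n * p / 2 ≤
      α * (1 - p₀) / (8 * r) * ((n : ℝ) ^ 2 * p)) (d : ℕ) :
    (SimpleGraph.binomialRandom (Fin n) p).real (stage Q δ 𝓕 x (D * m / p) E p d 0) ≤
      (1 + constU r p₀ α) * ((constT r p₀ α * D) ^ d *
        ((SimpleGraph.binomialRandom (Fin n) p).real (goodGraphs Q α δ 𝓕 y) +
          (p : ℝ) ^ edgeCount Q.graph * (1 - α / 4) ^ N)) := by
  set μ := SimpleGraph.binomialRandom (Fin n) p with hμ
  have hr' : (1 : ℝ) ≤ r := by exact_mod_cast hr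
  have hD' : (1 : ℝ) ≤ D := by exact_mod_cast hD
  have hα1 : α ≤ 1 := hα.trans (by rw [div_le_one (by positivity)]; linarith)
  have hq₀ : 0 < 1 - p₀ := by linarith
  have hA : 0 ≤ constA r p₀ := by unfold constA; positivity
  set S : ℕ → ℕ → Set (SimpleGraph (Fin n)) := fun k s => stage Q δ 𝓕 x (D * m / p) E p k s with hS
  have hSπ : ∀ k s, ∀ X ⊆ S k s, μ.real X ≤ (p : ℝ) ^ edgeCount Q.graph := by
    intro k s X hX
    rw [← real_superset]
    exact measureReal_mono fun G hG => (hX hG).2.2.1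
  have hDA : (D : ℝ) / (1 - p) ≤ constA r p₀ * D := by
    rw [constA, div_mul_eq_mul_div, div_le_div_iff₀ (by linarith) hq₀]
    have h1 : (D : ℝ) * (1 - p₀) ≤ D * (1 - p) := mul_le_mul_of_nonneg_left (by linarith) (by linarith)
    have h2 : 1 * ((D : ℝ) * (1 - p)) ≤ 2 * r * (D * (1 - p)) :=
      mul_le_mul_of_nonneg_right (by linarith) (mul_nonneg (by linarith) (by linarith))
    linarith
  have hsucc : ∀ j < N, N - (j + 1) + 1 = N - j := fun j hj => by omega
  have hrig : ∀ k, ∀ j < N, μ.real (S k (N - (j + 1)) ∩ rigidGraphs Q α δ) ≤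
      μ.real (goodGraphs Q α δ 𝓕 y) + constA r p₀ * D *
        μ.real (earlierStage Q δ 𝓕 x (D * m / p) E p k (N - j)) := by
    intro k j hj
    have := rigid_recursion (k := k) (s := N - (j + 1)) (E := E) hr hn hα hδ h𝓕 hy hp
      (hpp.trans_lt hp1) (D := D)
    rw [hsucc j hj] at this
    exact this.trans (add_le_add le_rfl (mul_le_mul_of_nonneg_right hDA measureReal_nonneg))
  have hnon : ∀ k, ∀ j < N, μ.real (S k (N - (j + 1)) \ rigidGraphs Q α δ) ≤
      constA r p₀ * μ.real (earlierStage Q δ 𝓕 x (D * m / p) E p k (N - j)) +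
        constA r p₀ * μ.real (S k (N - j) ∩ rigidGraphs Q α δ) +
        (1 - α / 2) * μ.real (S k (N - j) \ rigidGraphs Q α δ) := by
    intro k j hj
    have hle : ((N - (j + 1) : ℕ) : ℝ) + 1 ≤ N := by
      exact_mod_cast (by omega : N - (j + 1) + 1 ≤ N)
    have := nonrigid_recursion (k := k) (s := N - (j + 1)) (E := E) (Q := Q) (δ := δ) (𝓕 := 𝓕)
      (x := x) (B := D * m / p) hr hn hα0 hα1 hp hpp hp1 hE rfl (by linarith)
    rw [hsucc j hj] at this
    exact this
  have hsplit : ∀ k s, μ.real (S k s ∩ rigidGraphs Q α δ) + μ.real (S k s \ rigidGraphs Q α δ) =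
      μ.real (S k s) := fun k s => measureReal_inter_add_sdiff (measurableSet_graphs _)
  -- When `j` deletions remain, at most `N - j` edges have been deleted.
  have key := recursion_bound (N := N)
    (q := fun k j => μ.real (S k (N - j) ∩ rigidGraphs Q α δ))
    (ν := fun k j => μ.real (S k (N - j) \ rigidGraphs Q α δ))
    (g := μ.real (goodGraphs Q α δ 𝓕 y)) (π := (p : ℝ) ^ edgeCount Q.graph)
    (A := constA r p₀) (D := D) (β := α / 2) measureReal_nonneg (by positivity) hA hD'
    (by linarith) (by linarith)
    (fun k j => hSπ _ _ _ Set.inter_subset_left) (fun k j => hSπ _ _ _ Set.sdiff_subset)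
    (fun j hj => by simpa [earlierStage_zero] using hrig 0 j hj)
    (fun k j hj => by
      have := hrig (k + 1) j hj
      rw [earlierStage_succ] at this
      simp only [hsplit]
      exact this)
    (fun j hj => by simpa [earlierStage_zero] using hnon 0 j hj)
    (fun k j hj => by
      have := hnon (k + 1) j hj
      rw [earlierStage_succ] at this
      simp only [hsplit]
      exact this) rfl rfl d N le_rfl
  simp only [hsplit, Nat.sub_self] at key
  rw [show 1 - α / 4 = 1 - α / 2 / 2 by ring]
  exact key

lemma real_goodGraphs {Q : ColouredGraph n r} {α δ : ℝ} {𝓕 : Set (SimpleGraph (Fin n))} {y : ℕ}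
    {p : unitInterval} (hp : 0 < (p : ℝ)) :
    (SimpleGraph.binomialRandom (Fin n) p).real (goodGraphs Q α δ 𝓕 y) =
      (p : ℝ) ^ edgeCount Q.graph * coreProb p α δ Q 𝓕 y := by
  have h := real_superset p Q.graph
  rw [coreProb, measureReal_def (ProbabilityTheory.cond _ _),
    ProbabilityTheory.cond_apply (measurableSet_graphs _), ENNReal.toReal_mul, ENNReal.toReal_inv,
    ← measureReal_def, ← measureReal_def, h, mul_inv_cancel_left₀ (by positivity)]
  rfl

lemma IsTypical.isNearlyUniform {h : ℕ} {H : SimpleGraph (Fin h)} {η p : ℝ} {t : Tolerances}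
    {G : SimpleGraph (Fin n)} (hp : 0 ≤ p) (hG : IsTypical H r η p t G) :
    IsNearlyUniform (|t.ρ n| * ((n : ℝ) ^ 2 * p)) p 0 G := by
  refine ⟨G, le_rfl, le_rfl, fun k V hV => ?_⟩
  have h1 := (abs_le.1 (hG.edges k V hV).1).1
  have h2 : t.ρ n * ((n : ℝ) ^ 2 * p) ≤ |t.ρ n| * ((n : ℝ) ^ 2 * p) :=
    mul_le_mul_of_nonneg_right (le_abs_self _) (by positivity)
  linarith

/-- `d log(M / d)` is small compared to `M` when `d` is. -/
lemma mul_log_div_le {d M τ : ℝ} (hd : 0 < d) (hM : 0 < M) (hdM : d ≤ τ * M) :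
    d * Real.log (M / d) ≤ 2 * √τ * M := by
  have hτ : 0 ≤ τ := (pos_of_mul_pos_left (hd.trans_le hdM) hM.le).le
  have h1 : Real.log (M / d) ≤ 2 * √(M / d) := by
    have h2 : Real.log (M / d) = 2 * Real.log (√(M / d)) := by
      rw [Real.log_sqrt (by positivity)]; ring
    have h3 := Real.log_le_self (Real.sqrt_nonneg (M / d))
    linarith
  have h4 : d * √(M / d) ≤ √τ * M := by
    refine abs_le_of_sq_le_sq' ?_ (by positivity) |>.2
    rw [mul_pow, mul_pow, Real.sq_sqrt (by positivity), Real.sq_sqrt hτ]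
    have : d ^ 2 * (M / d) = d * M := by field_simp
    rw [this]
    nlinarith
  nlinarith

/-- The number of deletions is chosen so large that the error of the recursion is negligible, even
after multiplication with `Z ^ d`. -/
lemma pow_mul_pow_le_exp {Z θ K M : ℝ} {d N : ℕ} (hd : 1 ≤ d) (hZ : 0 < Z) (hθ : 0 < θ) (hM : 0 < M)
    (hZd : d * Z ≤ M) (hN : (K + 1) * (d * Real.log (M / d)) ≤ -Real.log θ * N) :
    Z ^ d * θ ^ N ≤ Real.exp (-(K * d * Real.log (M / d))) := by
  have hd' : (0 : ℝ) < d := by exact_mod_cast hd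
  have h1 : Z ≤ Real.exp (Real.log (M / d)) := by
    rw [Real.exp_log (by positivity), le_div_iff₀ hd']
    linarith
  have h2 : Z ^ d ≤ Real.exp (d * Real.log (M / d)) := by
    rw [Real.exp_nat_mul]
    exact pow_le_pow_left₀ hZ.le h1 d
  have h3 : θ ^ N = Real.exp (N * Real.log θ) := by
    rw [Real.exp_nat_mul, Real.exp_log hθ]
  calc Z ^ d * θ ^ N ≤ Real.exp (d * Real.log (M / d)) * Real.exp (N * Real.log θ) := by
        rw [h3]; exact mul_le_mul_of_nonneg_right h2 (Real.exp_pos _).le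
    _ = Real.exp (d * Real.log (M / d) + N * Real.log θ) := (Real.exp_add _ _).symm
    _ ≤ _ := Real.exp_le_exp.2 (by linarith)

end Assembly

end RandomTuran

end

theorem mainTheorem5 (r : ℕ) (hr : 2 ≤ r) (p₀ : ℝ) (hp₀ : 0 < p₀) (hp₀' : p₀ < 1) :
    ∃ α₀ : ℝ, 0 < α₀ ∧ ∀ α : ℝ, 0 < α → α ≤ α₀ →
    ∃ Z : ℝ, 0 < Z ∧
    ∃ δ₀ : ℝ, 0 < δ₀ ∧ ∀ δ : ℝ, 0 < δ → δ ≤ δ₀ →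
    ∀ (h : ℕ) (H : SimpleGraph (Fin h)),
      H.chromaticNumber = ((r + 1 : ℕ) : ℕ∞) →
      RandomTuran.IsEdgeCritical H →
      RandomTuran.IsStrictlyTwoBalanced H →
    ∀ ε κ η K : ℝ, 0 < ε → 0 < κ → 0 < η → 0 < K →
    ∀ p : ℕ → unitInterval,
      (∀ᶠ n in Filter.atTop,
        (1 + ε) * RandomTuran.pThreshold r H n ≤ (p n : ℝ) ∧ (p n : ℝ) ≤ p₀) →
    ∀ t : RandomTuran.Tolerances, t.Admissible →
    ∀ τ : ℕ → ℝ, Filter.Tendsto τ Filter.atTop (nhds 0) →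
    ∀ᶠ n in Filter.atTop,
      ∀ (Q : RandomTuran.ColouredGraph n r) (d D m x : ℕ) (𝓕 : Set (SimpleGraph (Fin n))),
        Q.InFamily κ η (p n) t →
        1 ≤ D →
        (∀ ω ∈ 𝓕, Disjoint ω Q.graph) →
        (d : ℝ) ≤ τ n * ((n : ℝ) ^ 2 * p n) →
        (RandomTuran.edgeCount Q.graph : ℝ) ≤ τ n * ((n : ℝ) ^ 2 * p n) →
        (d : ENNReal) ≤ (Q.vMin : ENNReal) *
          ENNReal.ofReal (min ((n : ℝ) * p n) (δ / (2 * (r : ℝ) ^ 3) * n)) →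
        (SimpleGraph.binomialRandom (Fin n) (p n)).real
            {G | ((min (n.choose 2) (RandomTuran.linkCount 𝓕 G) : ℕ) : ℝ) ≤ D * m / (p n : ℝ) ∧
              RandomTuran.IsTypical H r η (p n) t G ∧ G ∈ Q.bad δ 𝓕 d x} ≤
          (p n : ℝ) ^ RandomTuran.edgeCount Q.graph * (D : ℝ) ^ d *
            (Z ^ d * RandomTuran.coreProb (p n) α δ Q 𝓕 (x + m + r ^ 2 * (d + 1)) +
              Real.exp (-(K * d * Real.log ((n : ℝ) ^ 2 * p n / d)))) := by

  have hr0 : 0 < r := by omega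
  have hr' : (2 : ℝ) ≤ r := by exact_mod_cast hr
  refine ⟨1 / (16 * r), by positivity, fun α hα0 hα => ?_⟩
  have hq₀ : 0 < 1 - p₀ := by linarith
  have hA : 0 ≤ RandomTuran.constA r p₀ := by unfold RandomTuran.constA; positivity
  have hU : 0 ≤ RandomTuran.constU r p₀ α := by unfold RandomTuran.constU; positivity
  have hT : 0 < RandomTuran.constT r p₀ α := by unfold RandomTuran.constT; positivity
  set U := RandomTuran.constU r p₀ α
  set T := RandomTuran.constT r p₀ α
  have hZ : 0 < (1 + U) * T := by positivity
  refine ⟨(1 + U) * T, hZ, 1 / 2, by norm_num, ?_⟩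
  intro δ _ hδ h H _ _ _ ε κ η K _ _ _ hK p hp t ht τ hτ
  have hα1 : α < 1 := lt_of_le_of_lt hα (by rw [div_lt_one (by positivity)]; linarith)
  have hθ : 0 < 1 - α / 4 := by linarith
  have hlog : 0 < -Real.log (1 - α / 4) := by
    have := Real.log_neg hθ (by linarith); linarith
  set C := (K + 1) / -Real.log (1 - α / 4) with hC
  have hΓ : 0 < α * (1 - p₀) / (8 * r) := by positivity
  have hlim : Filter.Tendsto (fun n : ℕ => |t.ρ n| + 2 * C * √(τ n) + 2 * τ n + (1 / 2) * (1 / (n : ℝ)))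
      Filter.atTop (nhds 0) := by
    have h1 := ht.ρ.abs
    have h2 := (hτ.sqrt).const_mul (2 * C)
    have h3 := hτ.const_mul 2
    have h4 := (tendsto_one_div_atTop_nhds_zero_nat (𝕜 := ℝ)).const_mul (1 / 2)
    simpa using ((h1.add h2).add h3).add h4
  filter_upwards [hp, hlim.eventually_le_const hΓ, Filter.eventually_gt_atTop 0,
    hτ.eventually_le_const (by positivity : 0 < 1 / ((1 + U) * T))] with n hpn herr hn hτZ
  intro Q d D m x 𝓕 _ hD h𝓕 hd hQ _
  have hp0 : (0 : ℝ) ≤ p n := (p n).2.1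
  rcases Nat.eq_zero_or_pos d with rfl | hd1
  · -- For `d = 0`, the exponential term is `1`, and the probability of `Q ⊆ G` is a bound.
    have h1 : (SimpleGraph.binomialRandom (Fin n) (p n)).real
        {G | ((min (n.choose 2) (RandomTuran.linkCount 𝓕 G) : ℕ) : ℝ) ≤ D * m / (p n : ℝ) ∧
          RandomTuran.IsTypical H r η (p n) t G ∧ G ∈ Q.bad δ 𝓕 0 x} ≤
        (p n : ℝ) ^ RandomTuran.edgeCount Q.graph := by
      rw [← RandomTuran.real_superset]
      exact MeasureTheory.measureReal_mono fun G hG => hG.2.2.1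
    have h2 : 0 ≤ RandomTuran.coreProb (p n) α δ Q 𝓕 (x + m + r ^ 2 * (0 + 1)) :=
      MeasureTheory.measureReal_nonneg
    have h3 : Real.exp (-(K * (0 : ℕ) * Real.log ((n : ℝ) ^ 2 * p n / (0 : ℕ)))) = 1 := by simp
    rw [h3, pow_zero, pow_zero, mul_one, one_mul]
    exact h1.trans (le_mul_of_one_le_right (by positivity) (by linarith))
  have hd' : (1 : ℝ) ≤ d := by exact_mod_cast hd1
  set M : ℝ := (n : ℝ) ^ 2 * p n with hM
  have hM0 : 0 < M := by
    rcases (by positivity : 0 ≤ M).eq_or_lt with h0 | h0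
    · rw [← h0] at hd; linarith
    · exact h0
  have hn' : (0 : ℝ) < n := by exact_mod_cast hn
  have hp0' : (0 : ℝ) < p n := by
    rcases hp0.eq_or_lt with h0 | h0
    · rw [hM, ← h0] at hM0; simp at hM0
    · exact h0
  set N := ⌈C * (d * Real.log (M / d))⌉₊
  -- The hypothesis on `d` and `1 ≤ d` also show that `n²p` is large, namely `1 ≤ τ n²p`.
  have hτ0 : 0 < τ n := pos_of_mul_pos_left (by linarith : 0 < τ n * M) hM0.le
  have hZd : d * ((1 + U) * T) ≤ M := by
    have h1 : τ n * M * ((1 + U) * T) ≤ 1 / ((1 + U) * T) * M * ((1 + U) * T) := by gcongr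
    have h2 : 1 / ((1 + U) * T) * M * ((1 + U) * T) = M := by field_simp
    have h3 := mul_le_mul_of_nonneg_right hd hZ.le
    linarith
  have hU1 : 1 ≤ (1 + U) * T := by
    have : 1 ≤ T := by
      have : 0 ≤ 2 * RandomTuran.constA r p₀ * (1 + U) := by positivity
      simp only [T, RandomTuran.constT]; linarith
    nlinarith
  have hL : 0 ≤ Real.log (M / d) := by
    refine Real.log_nonneg ?_
    rw [le_div_iff₀ (by linarith)]
    nlinarith
  have hC0 : 0 < C := by positivity
  have hNM : (N : ℝ) ≤ 2 * C * √(τ n) * M + τ n * M := by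
    have h1 : (N : ℝ) < C * (d * Real.log (M / d)) + 1 := Nat.ceil_lt_add_one (by positivity)
    have h2 := mul_le_mul_of_nonneg_left
      (RandomTuran.mul_log_div_le (by linarith : (0 : ℝ) < d) hM0 hd) hC0.le
    linarith
  have hsmall : |t.ρ n| * M + N + RandomTuran.edgeCount Q.graph + n * p n / 2 ≤
      α * (1 - p₀) / (8 * r) * M := by
    have h1 := mul_le_mul_of_nonneg_right herr hM0.le
    have h2 : (1 / 2) * (1 / (n : ℝ)) * M = n * p n / 2 := by rw [hM]; field_simp
    linarith
  have hbound := RandomTuran.stage_bound (n := n) (Q := Q) (x := x) (m := m)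
    (y := x + m + r ^ 2 * (d + 1)) (D := D) (N := N) hr0 hn hα0 hα hδ h𝓕 (by omega) hp0' hpn.2 hp₀'
    (by positivity : 0 ≤ |t.ρ n| * M) hD hsmall d
  rw [RandomTuran.real_goodGraphs hp0'] at hbound
  set ξ := RandomTuran.coreProb (p n) α δ Q 𝓕 (x + m + r ^ 2 * (d + 1))
  have hξ : 0 ≤ ξ := MeasureTheory.measureReal_nonneg
  have hexp := RandomTuran.pow_mul_pow_le_exp (K := K) (N := N) hd1 hZ hθ hM0 hZd (by
    have h1 : C * (d * Real.log (M / d)) ≤ N := Nat.le_ceil _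
    have h2 := mul_le_mul_of_nonneg_left h1 hlog.le
    have h3 : -Real.log (1 - α / 4) * (C * (d * Real.log (M / d))) =
        (K + 1) * (d * Real.log (M / d)) := by
      rw [hC, ← mul_assoc, mul_div_cancel₀ _ hlog.ne']
    linarith)
  set π := (p n : ℝ) ^ RandomTuran.edgeCount Q.graph
  have hπ : 0 ≤ π := by positivity
  refine (MeasureTheory.measureReal_mono fun G hG => ?_).trans (hbound.trans ?_)
  · exact ⟨hG.1, hG.2.1.isNearlyUniform hp0, hG.2.2⟩
  · -- As `d ≥ 1`, the factor `1 + U` is absorbed by the `d`-th power.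
    have h1 : 1 + U ≤ (1 + U) ^ d := le_self_pow₀ (by linarith) (by omega)
    have hW : 0 ≤ (T * D) ^ d * (π * ξ + π * (1 - α / 4) ^ N) := by positivity
    calc _ ≤ (1 + U) ^ d * ((T * D) ^ d * (π * ξ + π * (1 - α / 4) ^ N)) :=
          mul_le_mul_of_nonneg_right h1 hW
      _ = π * D ^ d * (((1 + U) * T) ^ d * ξ + ((1 + U) * T) ^ d * (1 - α / 4) ^ N) := by
          rw [mul_pow, mul_pow]; ring
      _ ≤ _ := mul_le_mul_of_nonneg_left (by linarith) (by positivity)
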